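/- Let $K$ be a field. A *cone* is a finitely generated cone $C=\mathbb{R}_+x_1+\dots+\mathbb{R}_+x_m\subseteq\mathbb{R}^\delta$; a *face* of $C$ is a set $\{x\in C:\lambda(x)=0\}$ for a linear form $\lambda$ that is nonnegative on $C$ ($\lambda=0$ is allowed). A *conical complex* $\Sigma$ is a finite set of sets $c$ together with cones $C_c\subseteq\mathbb{R}^{\delta_c}$ with $\mathbb{R}C_c=\mathbb{R}^{\delta_c}$ and bijections $\pi_c:C_c\to c$ such that (a) $\pi_c(C')\in\Sigma$ for each face $C'$ of $C_c$, $c\in\Sigma$; and (b) for all $c,d\in\Sigma$ there are faces $C'$ of $C_c$ and $D'$ of $C_d$ such that $c\cap d=\pi_c(C')\cap\pi_d(D')$ and $\pi_d^{-1}\circ\pi_c$ restricts to a bijection $C'\to D'$ that extends to a linear isomorphism $\mathbb{R}C'\to\mathbb{R}D'$. A *monoidal complex* $\mathcal{M}$ supported by $\Sigma$ is a family $(M_c)_{c\in\Sigma}$ of finitely generated monoids $M_c\subseteq\mathbb{Z}^{\delta_c}$ with $\mathbb{R}_+M_c=C_c$ such that, for all $c,d\in\Sigma$, the map $\pi_d^{-1}\circ\pi_c$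 restricts to a monoid isomorphism from $M_c\cap\pi_c^{-1}(c\cap d)$ to $M_d\cap\pi_d^{-1}(c\cap d)$. Let $|\mathcal{M}|=\varinjlim M_c=\bigcup_c\pi_c(M_c)$, and regard each $M_c$ as a subset of $|\mathcal{M}|$. The *toric face ring* $K[\mathcal{M}]$ is the $K$-algebra with $K$-basis $t^a$, $a\in|\mathcal{M}|$, and multiplication $t^at^b=t^{a+b}$ if $a,b\in M_c$ for some $c\in\Sigma$, and $t^at^b=0$ otherwise. A monoid $M_c$ is *normal* if $M_c=\mathrm{gp}(M_c)\cap\mathbb{R}_+M_c$, where $\mathrm{gp}(M_c)$ is the group of differences of $M_c$. For a finite family $(a_e)_{e\in E}$ in $|\mathcal{M}|$ such that $\{a_e:a_e\in M_c\}$ generates $M_c$ for each $c\in\Sigma$, let $I_{\mathcal{M}}$ be the kernel of the surjective $K$-algebra homomorphism $K[X_e:e\in E]\to K[\mathcal{M}]$, $X_e\mapsto t^{a_e}$. For a weight vector $w\in\mathbb{N}^E$ ($\mathbb{N}$ the nonnegative integers), let $\mathrm{in}_w(I_{\mathcal{M}})$ be the ideal generated by the $w$-initial components $\mathrm{in}_w(f)$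 of all $f\in I_{\mathcal{M}}$, where $\mathrm{in}_w(f)$ is the $w$-homogeneous component of $f$ of highest $w$-degree. **Theorem.** For every monoidal complex $\mathcal{M}$ supported by a conical complex $\Sigma$, the following are equivalent: 1. All monoids $M_c$, $c\in\Sigma$, are normal. 2. There exist a finite family $(a_e)_{e\in E}$ of elements of $|\mathcal{M}|$ such that $\{a_e:a_e\in M_c\}$ generates $M_c$ for each $c\in\Sigma$, and a weight vector $w=(w_e)_{e\in E}\in\mathbb{N}^E$, such that $\mathrm{in}_w(I_{\mathcal{M}})$ is a radical ideal generated by monomials. -/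

import Mathlib

open scoped NNReal

/-! ### Cones, faces, conical complexes -/

/-- `F` is a face of the cone `C`: the intersection of `C` with a support hyperplane `{l = 0}`, where
`l` is a linear form that is nonnegative on `C`. The zero form is allowed, so `C` is a face of
itself. -/
def IsConeFace {n : ℕ} (C : PointedCone ℝ (Fin n → ℝ)) (F : Set (Fin n → ℝ)) : Prop :=
  ∃ l : (Fin n → ℝ) →ₗ[ℝ] ℝ, (∀ x ∈ C, 0 ≤ l x) ∧ F = {x | x ∈ C ∧ l x = 0}

/-- A conical complex on a set of points `X`: a finite set of subsets `c` of `X` (its faces), each of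
them identified by a bijection `chart c` with a full-dimensional finitely generated cone in a space
`ℝ ^ dim c`. (Only the values of `chart c` on the cone matter.) -/
structure ConicalComplex (X : Type*) where
  faces : Set (Set X)
  finite_faces : faces.Finite
  dim : faces → ℕ
  cone : ∀ c : faces, PointedCone ℝ (Fin (dim c) → ℝ)
  cone_fg : ∀ c, (cone c).FG
  span_cone : ∀ c, Submodule.span ℝ (cone c : Set (Fin (dim c) → ℝ)) = ⊤
  chart : ∀ c : faces, (Fin (dim c) → ℝ) → X
  bijOn_chart : ∀ c, Set.BijOn (chart c) (cone c) (c : Set X)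
  /-- The faces of the cones belong to the complex. -/
  face_mem : ∀ c F, IsConeFace (cone c) F → chart c '' F ∈ faces
  /-- `c ∩ d` corresponds to a face `F` of the cone of `c` and to a face `G` of the cone of `d`, and
  the change of charts from `F` to `G` is an isomorphism of cones: a bijection from `F` to `G` which
  extends to a linear isomorphism `φ` of the spaces spanned by them. -/
  inter : ∀ c d : faces, ∃ (F : Set (Fin (dim c) → ℝ)) (G : Set (Fin (dim d) → ℝ)),
    IsConeFace (cone c) F ∧ IsConeFace (cone d) G ∧
    (c : Set X) ∩ d = chart c '' F ∩ chart d '' G ∧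
    ∃ φ : Submodule.span ℝ F ≃ₗ[ℝ] Submodule.span ℝ G,
      (∀ x : Submodule.span ℝ F, x.1 ∈ F ↔ (φ x).1 ∈ G) ∧
      ∀ x : Submodule.span ℝ F, x.1 ∈ F → chart d (φ x).1 = chart c x.1

namespace ConicalComplex

variable {X : Type*} (S : ConicalComplex X)

theorem chart_add {c d : S.faces} {x y : Fin (S.dim c) → ℝ} {x' y' : Fin (S.dim d) → ℝ}
    (hx : x ∈ S.cone c) (hy : y ∈ S.cone c) (hx' : x' ∈ S.cone d) (hy' : y' ∈ S.cone d)
    (hxx : S.chart c x = S.chart d x') (hyy : S.chart c y = S.chart d y') :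
    S.chart c (x + y) = S.chart d (x' + y') := by
  obtain ⟨F, G, hF, hG, hcd, φ, hφ, hch⟩ := S.inter c d
  have key : ∀ z z', z ∈ S.cone c → z' ∈ S.cone d → S.chart c z = S.chart d z' →
      ∃ h : z ∈ F, (φ ⟨z, Submodule.subset_span h⟩ : Fin (S.dim d) → ℝ) = z' := by
    intro z z' hz hz' hzz
    have h1 : S.chart c z ∈ (c : Set X) ∩ d :=
      ⟨(S.bijOn_chart c).mapsTo hz, hzz ▸ (S.bijOn_chart d).mapsTo hz'⟩
    rw [hcd] at h1
    obtain ⟨⟨u, hu, hue⟩, -⟩ := h1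
    have hFC : F ⊆ S.cone c := by
      obtain ⟨l, -, rfl⟩ := hF
      exact fun _ h => h.1
    have hGC : G ⊆ S.cone d := by
      obtain ⟨l, -, rfl⟩ := hG
      exact fun _ h => h.1
    have huz : u = z := (S.bijOn_chart c).injOn (hFC hu) hz hue
    subst huz
    refine ⟨hu, (S.bijOn_chart d).injOn (hGC ((hφ _).1 hu)) hz' ?_⟩
    rw [hch _ hu, ← hzz]
  obtain ⟨hxF, hx1⟩ := key x x' hx hx' hxx
  obtain ⟨hyF, hy1⟩ := key y y' hy hy' hyy
  have hxy : x + y ∈ F := by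
    obtain ⟨l, -, rfl⟩ := hF
    exact ⟨add_mem hx hy, by rw [map_add, hxF.2, hyF.2, add_zero]⟩
  have := hch ⟨x + y, Submodule.subset_span hxy⟩ hxy
  rw [← this, ← hx1, ← hy1]
  congr 1
  rw [← Submodule.coe_add, ← map_add]
  rfl

theorem chart_mem_of_add {c d : S.faces} {x y : Fin (S.dim c) → ℝ}
    (hx : x ∈ S.cone c) (hy : y ∈ S.cone c) (h : S.chart c (x + y) ∈ (d : Set X)) :
    S.chart c x ∈ (d : Set X) := by
  obtain ⟨F, G, hF, hG, hcd, φ, hφ, hch⟩ := S.inter c d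
  have h1 : S.chart c (x + y) ∈ (c : Set X) ∩ d :=
    ⟨(S.bijOn_chart c).mapsTo (add_mem hx hy), h⟩
  rw [hcd] at h1
  obtain ⟨⟨u, hu, hue⟩, -⟩ := h1
  have hFC : F ⊆ S.cone c := by
    obtain ⟨l, -, rfl⟩ := hF
    exact fun _ h => h.1
  have hGC : G ⊆ S.cone d := by
    obtain ⟨l, -, rfl⟩ := hG
    exact fun _ h => h.1
  have huz : u = x + y := (S.bijOn_chart c).injOn (hFC hu) (add_mem hx hy) hue
  subst huz
  have hxF : x ∈ F := by
    obtain ⟨l, hl, rfl⟩ := hF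
    refine ⟨hx, ?_⟩
    have h2 := hu.2
    rw [map_add] at h2
    linarith [hl x hx, hl y hy]
  rw [← hch ⟨x, Submodule.subset_span hxF⟩ hxF]
  exact (S.bijOn_chart d).mapsTo (hGC ((hφ _).1 hxF))

end ConicalComplex

/-! ### Monoidal complexes -/

/-- A monoidal complex supported by the conical complex `S`: affine monoids `M_c ⊆ ℤ ^ dim c` which
generate the cones and are compatible with the changes of charts. -/
structure MonoidalComplex {X : Type*} (S : ConicalComplex X) where
  monoid : ∀ c : S.faces, AddSubmonoid (Fin (S.dim c) → ℝ)
  monoid_fg : ∀ c, (monoid c).FG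
  integral : ∀ c, ∀ x ∈ monoid c, ∀ i, ∃ z : ℤ, x i = z
  hull_monoid : ∀ c, PointedCone.hull ℝ (monoid c : Set (Fin (S.dim c) → ℝ)) = S.cone c
  /-- The change of charts over `c ∩ d` takes elements of `M_c` to elements of `M_d`. Since this is
  required for the pair `(d, c)` too, and changes of charts are additive, it restricts to an
  isomorphism between the parts of `M_c` and of `M_d` over `c ∩ d`. -/
  compat : ∀ c d, ∀ x ∈ monoid c, ∀ y ∈ S.cone d, S.chart c x = S.chart d y → y ∈ monoid d

/-- Normality of an affine monoid `N` in `ℝ ^ n`: `N = gp(N) ∩ ℝ₊ N`. -/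
def IsNormalMonoid {n : ℕ} (N : AddSubmonoid (Fin n → ℝ)) : Prop :=
  (N : Set (Fin n → ℝ)) =
    (AddSubgroup.closure (N : Set (Fin n → ℝ)) : Set (Fin n → ℝ)) ∩
      (PointedCone.hull ℝ (N : Set (Fin n → ℝ)) : Set (Fin n → ℝ))

namespace MonoidalComplex

variable {X : Type*} {S : ConicalComplex X} (M : MonoidalComplex S)

theorem monoid_le {c : S.faces} {x : Fin (S.dim c) → ℝ} (hx : x ∈ M.monoid c) :
    x ∈ S.cone c := by
  rw [← M.hull_monoid c]
  exact Submodule.subset_span hx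

/-- The direct limit `|M|` of the monoids `M_c`, realized as the union of their images in the support
of the conical complex. (Intersections of faces are faces and the monoids are compatible, so elements
of `M_c` and `M_d` agree in the direct limit exactly if they are the same point of `X`.) Its elements
are the monomials of the toric face ring. -/
def Elem : Type _ := {p : X // ∃ c, ∃ x ∈ M.monoid c, S.chart c x = p}

/-- The partial addition of `|M|`: `p + q = r` takes place in one of the monoids `M_c`. -/
def IsSum (p q r : M.Elem) : Prop :=
  ∃ c, ∃ x ∈ M.monoid c, ∃ y ∈ M.monoid c,
    S.chart c x = p.1 ∧ S.chart c y = q.1 ∧ S.chart c (x + y) = r.1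

variable {M}

theorem IsSum.symm {p q r : M.Elem} (h : M.IsSum p q r) : M.IsSum q p r := by
  obtain ⟨c, x, hx, y, hy, h1, h2, h3⟩ := h
  exact ⟨c, y, hy, x, hx, h2, h1, by rw [add_comm, h3]⟩

theorem IsSum.unique {p q r r' : M.Elem} (h : M.IsSum p q r) (h' : M.IsSum p q r') : r = r' := by
  obtain ⟨c, x, hx, y, hy, h1, h2, h3⟩ := h
  obtain ⟨d, x', hx', y', hy', h1', h2', h3'⟩ := h'
  apply Subtype.ext
  rw [← h3, ← h3']
  exact S.chart_add (M.monoid_le hx) (M.monoid_le hy) (M.monoid_le hx') (M.monoid_le hy')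
    (h1.trans h1'.symm) (h2.trans h2'.symm)

theorem exists_mem_of_chart_mem {c d : S.faces} {x : Fin (S.dim c) → ℝ} (hx : x ∈ M.monoid c)
    (h : S.chart c x ∈ (d : Set X)) : ∃ x' ∈ M.monoid d, S.chart d x' = S.chart c x := by
  obtain ⟨x', hx', he⟩ := (S.bijOn_chart d).surjOn h
  exact ⟨x', M.compat c d x hx x' hx' he.symm, he⟩

theorem IsSum.assoc {p q r s t : M.Elem} (h : M.IsSum p q s) (h' : M.IsSum s r t) :
    ∃ u, M.IsSum q r u ∧ M.IsSum p u t := by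
  obtain ⟨c, x, hx, y, hy, h1, h2, h3⟩ := h
  obtain ⟨d, s', hs', z, hz, h4, h5, h6⟩ := h'
  have hxy : S.chart c (x + y) ∈ (d : Set X) := by
    rw [h3, ← h4]
    exact (S.bijOn_chart d).mapsTo (M.monoid_le hs')
  have hyx : S.chart c (y + x) ∈ (d : Set X) := by rwa [add_comm]
  obtain ⟨x', hx', hxe⟩ := M.exists_mem_of_chart_mem hx
    (S.chart_mem_of_add (M.monoid_le hx) (M.monoid_le hy) hxy)
  obtain ⟨y', hy', hye⟩ := M.exists_mem_of_chart_mem hy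
    (S.chart_mem_of_add (M.monoid_le hy) (M.monoid_le hx) hyx)
  have hs : s' = x' + y' := by
    apply (S.bijOn_chart d).injOn (M.monoid_le hs') (M.monoid_le (add_mem hx' hy'))
    rw [h4, ← h3]
    exact S.chart_add (M.monoid_le hx) (M.monoid_le hy) (M.monoid_le hx') (M.monoid_le hy')
      hxe.symm hye.symm
  subst hs
  exact ⟨⟨S.chart d (y' + z), d, y' + z, add_mem hy' hz, rfl⟩,
    ⟨d, y', hy', z, hz, hye.trans h2, h5, rfl⟩,
    ⟨d, x', hx', y' + z, add_mem hy' hz, hxe.trans h1, rfl, by rw [← add_assoc, h6]⟩⟩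

variable (M)

/-- The family `a` generates all monoids of the complex: for each `c`, the members of the family that
lie in `M_c` generate `M_c`. -/
def Generates {n : ℕ} (a : Fin n → M.Elem) : Prop :=
  ∀ c, AddSubmonoid.closure {x | x ∈ M.monoid c ∧ ∃ e, (a e).1 = S.chart c x} = M.monoid c

end MonoidalComplex

/-! ### Toric face rings -/

/-- The toric face ring `K[M]`: the vector space with basis `t^a`, `a ∈ |M|`. -/
def ToricFaceRing (K : Type*) [Field K] {X : Type*} {S : ConicalComplex X}
    (M : MonoidalComplex S) : Type _ := M.Elem →₀ K

namespace ToricFaceRing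

variable {K : Type*} [Field K] {X : Type*} {S : ConicalComplex X} {M : MonoidalComplex S}

noncomputable instance : AddCommGroup (ToricFaceRing K M) :=
  inferInstanceAs (AddCommGroup (M.Elem →₀ K))

noncomputable instance : Module K (ToricFaceRing K M) :=
  inferInstanceAs (Module K (M.Elem →₀ K))

/-- The basis of the monomials `t^a`. -/
noncomputable def basis : Module.Basis M.Elem K (ToricFaceRing K M) :=
  Module.Basis.ofRepr (LinearEquiv.refl K (M.Elem →₀ K))

/-- The basis element `t^a`. -/
noncomputable def t (a : M.Elem) : ToricFaceRing K M := basis a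

open Classical in
/-- The product `t^a t^b`: it is `t^(a+b)` if `a` and `b` lie in a common monoid `M_c`, else `0`. -/
noncomputable def tMul (a b : M.Elem) : ToricFaceRing K M :=
  if h : ∃ r, M.IsSum a b r then t h.choose else 0

/-- The bilinear extension of the product of the basis elements. -/
noncomputable def mulBilin :
    ToricFaceRing K M →ₗ[K] ToricFaceRing K M →ₗ[K] ToricFaceRing K M :=
  basis.constr K fun a => basis.constr K fun b => tMul a b

noncomputable instance : Mul (ToricFaceRing K M) := ⟨fun f g => mulBilin f g⟩

open Classical in
/-- The unit element `t^0`. (If the complex has no faces at all, the ring is zero.) -/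
noncomputable instance : One (ToricFaceRing K M) :=
  ⟨if h : Nonempty S.faces then
    t ⟨S.chart h.some 0, h.some, 0, (M.monoid h.some).zero_mem, rfl⟩ else 0⟩

open Classical in
theorem one_def : (1 : ToricFaceRing K M) = if h : Nonempty S.faces then
    t ⟨S.chart h.some 0, h.some, 0, (M.monoid h.some).zero_mem, rfl⟩ else 0 := rfl

theorem mul_def (f g : ToricFaceRing K M) : f * g = mulBilin f g := rfl

theorem t_mul_t (a b : M.Elem) : (t a * t b : ToricFaceRing K M) = tMul a b := by
  rw [mul_def, mulBilin, t, t, Module.Basis.constr_basis, Module.Basis.constr_basis]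

theorem t_mul_t_of_isSum {a b r : M.Elem} (h : M.IsSum a b r) :
    (t a * t b : ToricFaceRing K M) = t r := by
  have h' : ∃ r, M.IsSum a b r := ⟨r, h⟩
  rw [t_mul_t, tMul, dif_pos h', h'.choose_spec.unique h]

theorem t_mul_t_of_not {a b : M.Elem} (h : ¬ ∃ r, M.IsSum a b r) :
    (t a * t b : ToricFaceRing K M) = 0 := by
  rw [t_mul_t, tMul, dif_neg h]

theorem induction {P : ToricFaceRing K M → Prop} (f : ToricFaceRing K M) (h0 : P 0)
    (hadd : ∀ f g, P f → P g → P (f + g)) (hsmul : ∀ (k : K) f, P f → P (k • f))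
    (ht : ∀ a, P (t a)) : P f := by
  have hf : f ∈ Submodule.span K (Set.range (basis : Module.Basis M.Elem K (ToricFaceRing K M))) :=
    basis.mem_span f
  induction hf using Submodule.span_induction with
  | mem x hx =>
    obtain ⟨a, rfl⟩ := hx
    exact ht a
  | zero => exact h0
  | add x y _ _ hx hy => exact hadd x y hx hy
  | smul k x _ hx => exact hsmul k x hx

theorem add_mul' (f g h : ToricFaceRing K M) : (f + g) * h = f * h + g * h := by
  simp only [mul_def, map_add, LinearMap.add_apply]

theorem mul_add' (f g h : ToricFaceRing K M) : f * (g + h) = f * g + f * h := by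
  simp only [mul_def, map_add]

theorem zero_mul' (f : ToricFaceRing K M) : 0 * f = 0 := by
  simp only [mul_def, map_zero, LinearMap.zero_apply]

theorem mul_zero' (f : ToricFaceRing K M) : f * 0 = 0 := by
  simp only [mul_def, map_zero]

theorem smul_mul' (k : K) (f g : ToricFaceRing K M) : (k • f) * g = k • (f * g) := by
  simp only [mul_def, map_smul, LinearMap.smul_apply]

theorem mul_smul' (k : K) (f g : ToricFaceRing K M) : f * (k • g) = k • (f * g) := by
  simp only [mul_def, map_smul]

theorem mul_comm' (f g : ToricFaceRing K M) : f * g = g * f := by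
  induction f using induction with
  | h0 => rw [zero_mul', mul_zero']
  | hadd f f' hf hf' => rw [add_mul', mul_add', hf, hf']
  | hsmul k f hf => rw [smul_mul', mul_smul', hf]
  | ht a =>
    induction g using induction with
    | h0 => rw [zero_mul', mul_zero']
    | hadd f f' hf hf' => rw [add_mul', mul_add', hf, hf']
    | hsmul k f hf => rw [smul_mul', mul_smul', hf]
    | ht b =>
      by_cases h : ∃ r, M.IsSum a b r
      · obtain ⟨r, hr⟩ := h
        rw [t_mul_t_of_isSum hr, t_mul_t_of_isSum hr.symm]
      · rw [t_mul_t_of_not h, t_mul_t_of_not fun ⟨r, hr⟩ => h ⟨r, hr.symm⟩]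

theorem mul_assoc_t (a b c : M.Elem) :
    (t a * t b * t c : ToricFaceRing K M) = t a * (t b * t c) := by
  by_cases h : ∃ s u, M.IsSum a b s ∧ M.IsSum s c u
  · obtain ⟨s, u, h1, h2⟩ := h
    obtain ⟨v, h3, h4⟩ := h1.assoc h2
    rw [t_mul_t_of_isSum h1, t_mul_t_of_isSum h2, t_mul_t_of_isSum h3, t_mul_t_of_isSum h4]
  · have hl : (t a * t b * t c : ToricFaceRing K M) = 0 := by
      by_cases h1 : ∃ s, M.IsSum a b s
      · obtain ⟨s, hs⟩ := h1
        rw [t_mul_t_of_isSum hs, t_mul_t_of_not fun ⟨u, hu⟩ => h ⟨s, u, hs, hu⟩]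
      · rw [t_mul_t_of_not h1, zero_mul']
    have hr : (t a * (t b * t c) : ToricFaceRing K M) = 0 := by
      by_cases h1 : ∃ s, M.IsSum b c s
      · obtain ⟨s, hs⟩ := h1
        rw [t_mul_t_of_isSum hs, t_mul_t_of_not]
        rintro ⟨u, hu⟩
        obtain ⟨v, h3, h4⟩ := hs.symm.assoc hu.symm
        exact h ⟨v, u, h3.symm, h4.symm⟩
      · rw [t_mul_t_of_not h1, mul_zero']
    rw [hl, hr]

theorem mul_assoc' (f g h : ToricFaceRing K M) : f * g * h = f * (g * h) := by
  induction f using induction with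
  | h0 => simp only [zero_mul']
  | hadd f f' hf hf' => simp only [add_mul', hf, hf']
  | hsmul k f hf => simp only [smul_mul', hf]
  | ht a =>
    induction g using induction with
    | h0 => simp only [zero_mul', mul_zero']
    | hadd f f' hf hf' => simp only [add_mul', mul_add', hf, hf']
    | hsmul k f hf => simp only [smul_mul', mul_smul', hf]
    | ht b =>
      induction h using induction with
      | h0 => simp only [mul_zero']
      | hadd f f' hf hf' => simp only [mul_add', hf, hf']
      | hsmul k f hf => simp only [mul_smul', hf]
      | ht c => exact mul_assoc_t a b c

theorem one_mul' (f : ToricFaceRing K M) : 1 * f = f := by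
  induction f using induction with
  | h0 => rw [mul_zero']
  | hadd f f' hf hf' => rw [mul_add', hf, hf']
  | hsmul k f hf => rw [mul_smul', hf]
  | ht a =>
    obtain ⟨p, c, x, hx, rfl⟩ := a
    have h : Nonempty S.faces := ⟨c⟩
    rw [one_def, dif_pos h]
    refine t_mul_t_of_isSum ⟨c, 0, zero_mem _, x, hx, ?_, rfl, by rw [zero_add]⟩
    obtain ⟨F, G, ⟨l, -, rfl⟩, hG, hcd, φ, hφ, hch⟩ := S.inter c h.some
    have h0 := hch 0 ⟨zero_mem _, map_zero l⟩
    rw [map_zero] at h0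
    exact h0.symm

noncomputable instance : CommRing (ToricFaceRing K M) :=
  { (inferInstance : AddCommGroup (ToricFaceRing K M)),
    (inferInstance : Mul (ToricFaceRing K M)),
    (inferInstance : One (ToricFaceRing K M)) with
    left_distrib := mul_add'
    right_distrib := add_mul'
    zero_mul := zero_mul'
    mul_zero := mul_zero'
    mul_assoc := mul_assoc'
    mul_comm := mul_comm'
    one_mul := one_mul'
    mul_one := fun f => by rw [mul_comm', one_mul'] }

noncomputable instance : Algebra K (ToricFaceRing K M) :=
  Algebra.ofModule smul_mul' mul_smul'

end ToricFaceRing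

/-- The presentation ideal `I_M` of `K[M]` for a family `a`: the kernel of the homomorphism
`K[X_e : e] → K[M]`, `X_e ↦ t^(a_e)`. -/
noncomputable def MonoidalComplex.presentationIdeal (K : Type*) [Field K] {X : Type*}
    {S : ConicalComplex X} (M : MonoidalComplex S) {n : ℕ} (a : Fin n → M.Elem) :
    Ideal (MvPolynomial (Fin n) K) :=
  RingHom.ker (MvPolynomial.aeval fun e => (ToricFaceRing.t (a e) : ToricFaceRing K M))

/-! ### Initial ideals with respect to weight vectors -/

section Initial

variable {K : Type*} [Field K] {n : ℕ}

/-- The `w`-initial component of `f`: its `w`-homogeneous component of highest degree. -/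
noncomputable def initialComponent (w : Fin n → ℕ) (f : MvPolynomial (Fin n) K) :
    MvPolynomial (Fin n) K :=
  MvPolynomial.weightedHomogeneousComponent w (MvPolynomial.weightedTotalDegree w f) f

/-- The `w`-initial ideal of `I`, generated by the `w`-initial components of its elements. (They span
it as a vector space already.) -/
noncomputable def initialIdeal (w : Fin n → ℕ) (I : Ideal (MvPolynomial (Fin n) K)) :
    Ideal (MvPolynomial (Fin n) K) :=
  Ideal.span (initialComponent w '' I)

/-- A monomial ideal is an ideal that is generated by monomials. -/
def IsMonomialIdeal (I : Ideal (MvPolynomial (Fin n) K)) : Prop :=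
  ∃ A : Set (Fin n →₀ ℕ), I = Ideal.span ((fun u => MvPolynomial.monomial u (1 : K)) '' A)

end Initial

/-!
A toric face ring is normal in the sense of the theorem exactly if it admits a squarefree Gröbner
degeneration. The link between the two sides is the set of *standard* monomials, those which do not
belong to the initial ideal. The presentation ideal is generated by the monomials that vanish in
`K[M]` and by the differences of monomials that represent the same element of `|M|`. Therefore the
initial ideal is a monomial ideal exactly if each element of `|M|` is represented by a unique monomial
of least weight, its standard monomial, and a monomial ideal is radical exactly if membership of a
monomial depends on its support only.

*From radical monomial initial ideals to normality* (`isNormalMonoid_of_standard`). Let `x` be in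
`gp(M_c) ∩ ℝ₊ M_c`. Some multiple `k • x` belongs to `M_c`. Choose a maximal standard support `G` that
contains the support of the standard monomial of `k • x`, and let `g` be the sum of the vectors of
`G`. For `v ∈ M_c` consider the standard monomials of `j • g + v`, `j = 0, 1, …`. By Dickson's lemma two
of them are comparable; their difference is standard and represents a multiple of `g`, hence is a
multiple of the monomial of `g`, and by maximality `v` is an integral combination of `G`. So `G`
generates `gp(M_c)`, and since monomials supported by `G` are determined by the elements they
represent, the coefficients of `x` with respect to `G` are nonnegative.

*From normality to radical monomial initial ideals.* We construct a coherent unimodular triangulation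
of the complex. A triangulation is encoded by the optimal (least weight) real conical combinations
of the points of the complex, for generic weights; see `Triangulation`. Genericity is encoded by a
filter on the space of weights, so that a weight can be chosen to be infinitely large or infinitely
close to a given value. A first triangulation is given by the weights `N ^ i` for `N → ∞`, with
Carathéodory's argument for the existence of optimal combinations
(`MonoidalComplex.exists_triangulation`). A stellar subdivision at an element `x` of `|M|` amounts to
adding the vertex `x` with a weight that is infinitesimally smaller than that of its optimal combination
(`Triangulation.exists_stellar`). If `M` is normal and the triangulation is not unimodular, then a
face of maximal multiplicity contains such an element `x` in its half-open parallelepiped, and the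
subdivision at `x` reduces the number of these faces (`Triangulation.exists_unimodular`). When all
faces are unimodular, the optimal combinations of elements of `|M|` have integral coefficients, and
they are the standard monomials for a weight vector that satisfies finitely many strict inequalities;
by Dickson's lemma these suffice for all the others
(`MonoidalComplex.exists_weight_of_finite_inequalities`).
-/

section

open ConicalComplex Filter Topology

/-! ### Coordinates and conical combinations in a conical complex -/

namespace ConicalComplex

variable {X : Type*} (S : ConicalComplex X)

/-- The coordinates of a point `p ∈ c` in the chart of `c` (a junk value if `p ∉ c`). -/
noncomputable def coord (c : S.faces) (p : X) : Fin (S.dim c) → ℝ :=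
  Function.invFunOn (S.chart c) (S.cone c : Set (Fin (S.dim c) → ℝ)) p

variable {S}

theorem coord_mem {c : S.faces} {p : X} (hp : p ∈ (c : Set X)) : S.coord c p ∈ S.cone c :=
  Function.invFunOn_mem ((S.bijOn_chart c).surjOn hp)

theorem chart_coord {c : S.faces} {p : X} (hp : p ∈ (c : Set X)) :
    S.chart c (S.coord c p) = p :=
  Function.invFunOn_eq ((S.bijOn_chart c).surjOn hp)

theorem chart_mem {c : S.faces} {x : Fin (S.dim c) → ℝ} (hx : x ∈ S.cone c) :
    S.chart c x ∈ (c : Set X) :=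
  (S.bijOn_chart c).mapsTo hx

theorem coord_chart {c : S.faces} {x : Fin (S.dim c) → ℝ} (hx : x ∈ S.cone c) :
    S.coord c (S.chart c x) = x :=
  (S.bijOn_chart c).injOn (coord_mem (chart_mem hx)) hx (chart_coord (chart_mem hx))

theorem coord_injOn {c : S.faces} {p q : X} (hp : p ∈ (c : Set X)) (hq : q ∈ (c : Set X))
    (h : S.coord c p = S.coord c q) : p = q := by
  rw [← chart_coord hp, h, chart_coord hq]

variable (S) in
/-- The part `c ∩ d` of `c` is cut out by a linear form that is nonnegative on the cone of `c`, and
the change of charts on it is the restriction of a linear map defined on the whole space. -/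
theorem exists_transition (c d : S.faces) :
    ∃ (l : (Fin (S.dim c) → ℝ) →ₗ[ℝ] ℝ)
      (ψ : (Fin (S.dim c) → ℝ) →ₗ[ℝ] (Fin (S.dim d) → ℝ)),
      (∀ x ∈ S.cone c, 0 ≤ l x) ∧
      (∀ p ∈ (c : Set X), p ∈ (d : Set X) ↔ l (S.coord c p) = 0) ∧
      ∀ p ∈ (c : Set X), p ∈ (d : Set X) → ψ (S.coord c p) = S.coord d p := by
  obtain ⟨F, G, ⟨l, hl, hF⟩, ⟨l', -, hG⟩, hcd, φ, hφ, hch⟩ := S.inter c d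
  have hFm : ∀ x, x ∈ F ↔ x ∈ S.cone c ∧ l x = 0 := fun x => by rw [hF]; rfl
  have hGm : ∀ x ∈ G, x ∈ S.cone d := fun x hx => by rw [hG] at hx; exact hx.1
  obtain ⟨ψ, hψ⟩ := LinearMap.exists_extend
    ((Submodule.subtype _).comp φ.toLinearMap : Submodule.span ℝ F →ₗ[ℝ] (Fin (S.dim d) → ℝ))
  have hmem : ∀ p ∈ (c : Set X), p ∈ (d : Set X) → S.coord c p ∈ F := by
    intro p hc hd
    have h1 : p ∈ (c : Set X) ∩ d := ⟨hc, hd⟩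
    rw [hcd] at h1
    obtain ⟨⟨u, hu, rfl⟩, -⟩ := h1
    rwa [coord_chart ((hFm u).1 hu).1]
  have hψF : ∀ x (hx : x ∈ F), ψ x = φ ⟨x, Submodule.subset_span hx⟩ := by
    intro x hx
    have := LinearMap.congr_fun hψ ⟨x, Submodule.subset_span hx⟩
    simpa using this
  have hmap : ∀ p ∈ (c : Set X), S.coord c p ∈ F →
      p ∈ (d : Set X) ∧ ψ (S.coord c p) = S.coord d p := by
    intro p hc hp
    have h1 := (hφ ⟨_, Submodule.subset_span hp⟩).1 hp
    have h2 := hch ⟨_, Submodule.subset_span hp⟩ hp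
    rw [chart_coord hc] at h2
    have h3 : p ∈ (d : Set X) := h2 ▸ chart_mem (hGm _ h1)
    refine ⟨h3, ?_⟩
    rw [hψF _ hp, ← coord_chart (hGm _ h1), h2]
  refine ⟨l, ψ, hl, fun p hc => ⟨fun hd => ((hFm _).1 (hmem p hc hd)).2, fun h => ?_⟩,
    fun p hc hd => (hmap p hc (hmem p hc hd)).2⟩
  exact (hmap p hc ((hFm _).2 ⟨coord_mem hc, h⟩)).1

variable {ι : Type*}

variable (S) in
/-- The linear combination, in the coordinates of `c`, of the points `a i` with coefficients `q`. -/
noncomputable def comb (c : S.faces) (a : ι → X) : (ι →₀ ℝ) →ₗ[ℝ] (Fin (S.dim c) → ℝ) :=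
  Finsupp.linearCombination ℝ fun i => S.coord c (a i)

theorem comb_apply (c : S.faces) (a : ι → X) (q : ι →₀ ℝ) :
    S.comb c a q = q.sum fun i r => r • S.coord c (a i) :=
  Finsupp.linearCombination_apply ℝ q

@[simp] theorem comb_single (c : S.faces) (a : ι → X) (i : ι) (r : ℝ) :
    S.comb c a (Finsupp.single i r) = r • S.coord c (a i) :=
  Finsupp.linearCombination_single ℝ r i

variable (S) in
/-- `q` is supported by indices `i` for which `a i` lies in the face `c`. -/
def InFace (c : S.faces) (a : ι → X) (q : ι →₀ ℝ) : Prop :=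
  ∀ i, q i ≠ 0 → a i ∈ (c : Set X)

variable (S) in
/-- In the face `c`, the point `p` is the linear combination of the points `a i` with
coefficients `q`. -/
def IsComb (c : S.faces) (a : ι → X) (q : ι →₀ ℝ) (p : X) : Prop :=
  S.InFace c a q ∧ p ∈ (c : Set X) ∧ S.comb c a q = S.coord c p

variable {c d : S.faces} {a : ι → X} {q q' : ι →₀ ℝ} {p : X}

theorem InFace.add (h : S.InFace c a q) (h' : S.InFace c a q') : S.InFace c a (q + q') := by
  intro i hi
  by_cases h0 : q i = 0
  · exact h' i fun h1 => hi (by simp [h0, h1])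
  · exact h i h0

theorem InFace.smul (h : S.InFace c a q) (r : ℝ) : S.InFace c a (r • q) :=
  fun i hi => h i fun h1 => hi (by simp [h1])

theorem InFace.neg (h : S.InFace c a q) : S.InFace c a (-q) :=
  fun i hi => h i fun h1 => hi (by simp [h1])

theorem InFace.sub (h : S.InFace c a q) (h' : S.InFace c a q') : S.InFace c a (q - q') := by
  rw [sub_eq_add_neg]
  exact h.add h'.neg

theorem InFace.single {i : ι} (hi : a i ∈ (c : Set X)) (r : ℝ) :
    S.InFace c a (Finsupp.single i r) := by
  intro j hj
  rcases eq_or_ne i j with rfl | hij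
  · exact hi
  · simp [Finsupp.single_eq_of_ne' hij] at hj

theorem map_comb {W : Type*} [AddCommGroup W] [Module ℝ W]
    (f : (Fin (S.dim c) → ℝ) →ₗ[ℝ] W) (a : ι → X) (q : ι →₀ ℝ) :
    f (S.comb c a q) = q.sum fun i r => r • f (S.coord c (a i)) := by
  rw [comb_apply, map_finsuppSum]
  simp

theorem InFace.comb_mem (h : S.InFace c a q) (hq : 0 ≤ q) : S.comb c a q ∈ S.cone c := by
  rw [comb_apply]
  refine Submodule.sum_mem _ fun i hi => ?_
  exact PointedCone.smul_mem _ (hq i) (coord_mem (h i (Finsupp.mem_support_iff.1 hi)))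

/-- A conical combination of points of `c` is a point of `c`. -/
theorem InFace.isComb (h : S.InFace c a q) (hq : 0 ≤ q) :
    S.IsComb c a q (S.chart c (S.comb c a q)) :=
  ⟨h, chart_mem (h.comb_mem hq), (coord_chart (h.comb_mem hq)).symm⟩

/-- If a conical combination of points of `c` with positive coefficients lies in `d`, then so do all
these points, and the point is their combination in `d` as well. -/
theorem IsComb.transport (h : S.IsComb c a q p) (hq : 0 ≤ q) (hp : p ∈ (d : Set X)) :
    S.IsComb d a q p := by
  obtain ⟨l, ψ, hl, hlp, hψ⟩ := S.exists_transition c d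
  obtain ⟨h1, h2, h3⟩ := h
  have h4 : ∀ i, q i ≠ 0 → a i ∈ (d : Set X) := by
    have h5 := (hlp p h2).1 hp
    rw [← h3, map_comb, Finsupp.sum, Finset.sum_eq_zero_iff_of_nonneg] at h5
    · intro i hi
      have := h5 i (Finsupp.mem_support_iff.2 hi)
      rw [smul_eq_mul, mul_eq_zero, or_iff_right hi] at this
      exact (hlp _ (h1 i hi)).2 this
    · exact fun i hi => mul_nonneg (hq i)
        (hl _ (coord_mem (h1 i (Finsupp.mem_support_iff.1 hi))))
  refine ⟨h4, hp, ?_⟩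
  rw [← hψ p h2 hp, ← h3, map_comb, comb_apply]
  refine Finset.sum_congr rfl fun i hi => ?_
  have hi := Finsupp.mem_support_iff.1 hi
  beta_reduce
  rw [hψ _ (h1 i hi) (h4 i hi)]

/-- If a point of `c` is a combination of points that lie in `d` as well, then it lies in `d`. -/
theorem IsComb.transport_of_inFace (h : S.IsComb c a q p) (hq : 0 ≤ q) (hd : S.InFace d a q) :
    S.IsComb d a q p := by
  refine h.transport hq ?_
  obtain ⟨l, ψ, hl, hlp, hψ⟩ := S.exists_transition c d
  obtain ⟨h1, h2, h3⟩ := h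
  rw [hlp p h2, ← h3, map_comb]
  refine Finset.sum_eq_zero fun i hi => ?_
  have hi := Finsupp.mem_support_iff.1 hi
  beta_reduce
  rw [(hlp _ (h1 i hi)).1 (hd i hi), smul_zero]

theorem IsComb.unique {p' : X} (h : S.IsComb c a q p) (h' : S.IsComb d a q p') (hq : 0 ≤ q) :
    p = p' := by
  have h1 := h.transport_of_inFace hq h'.1
  exact coord_injOn h1.2.1 h'.2.1 (h1.2.2.symm.trans h'.2.2)

end ConicalComplex

namespace MonoidalComplex

variable {X : Type*} {S : ConicalComplex X} {M : MonoidalComplex S}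

theorem coord_mem_monoid {c : S.faces} (y : M.Elem) (hy : y.1 ∈ (c : Set X)) :
    S.coord c y.1 ∈ M.monoid c := by
  obtain ⟨d, x, hx, hxy⟩ := y.2
  exact M.compat d c x hx _ (coord_mem hy) (by rw [chart_coord hy, hxy])

theorem exists_elem {c : S.faces} {x : Fin (S.dim c) → ℝ} (hx : x ∈ M.monoid c) :
    ∃ y : M.Elem, y.1 ∈ (c : Set X) ∧ S.coord c y.1 = x ∧ y.1 = S.chart c x :=
  ⟨⟨S.chart c x, c, x, hx, rfl⟩, chart_mem (M.monoid_le hx), coord_chart (M.monoid_le hx), rfl⟩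

theorem Elem.exists_face (y : M.Elem) : ∃ c : S.faces, y.1 ∈ (c : Set X) := by
  obtain ⟨d, x, hx, hxy⟩ := y.2
  exact ⟨d, hxy ▸ chart_mem (M.monoid_le hx)⟩

/-- Only finitely many integer vectors have bounded coordinates. -/
theorem finite_bounded_integral {n : ℕ} (B : Fin n → ℝ) :
    {x : Fin n → ℝ | (∀ i, ∃ z : ℤ, x i = z) ∧ ∀ i, |x i| ≤ B i}.Finite := by
  have h1 : (Set.Icc (fun i => -⌈B i⌉) (fun i => ⌈B i⌉) : Set (Fin n → ℤ)).Finite :=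
    Set.finite_Icc _ _
  refine (h1.image fun z i => (z i : ℝ)).subset ?_
  rintro x ⟨hx, hB⟩
  choose z hz using hx
  refine ⟨z, ⟨fun i => ?_, fun i => ?_⟩, funext fun i => (hz i).symm⟩
  · have := (abs_le.1 (hB i)).1
    have h2 : -(⌈B i⌉ : ℝ) ≤ z i := by
      rw [← hz]
      linarith [Int.le_ceil (B i)]
    exact_mod_cast h2
  · have := (abs_le.1 (hB i)).2
    have h2 : (z i : ℝ) ≤ ⌈B i⌉ := by
      rw [← hz]
      linarith [Int.le_ceil (B i)]
    exact_mod_cast h2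

end MonoidalComplex

/-! ### Coherent triangulations -/

section MaxMultiple

variable {ι : Type*}

/-- The largest `r` with `r • u ≤ s`, for `u ≠ 0` and nonnegative `s` and `u`. -/
noncomputable def maxMultiple (s u : ι →₀ ℝ) : ℝ :=
  if h : u.support.Nonempty then u.support.inf' h fun e => s e / u e else 0

variable {s u : ι →₀ ℝ}

theorem maxMultiple_nonneg (hs : 0 ≤ s) (hu : 0 ≤ u) : 0 ≤ maxMultiple s u := by
  unfold maxMultiple
  split_ifs with h
  · exact (Finset.le_inf'_iff _ _).2 fun e _ => div_nonneg (hs e) (hu e)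
  · exact le_rfl

theorem maxMultiple_mul_le (hs : 0 ≤ s) (hu : 0 ≤ u) (e : ι) : maxMultiple s u * u e ≤ s e := by
  by_cases he : u e = 0
  · simpa [he] using hs e
  · have he' := Finsupp.mem_support_iff.2 he
    have hpos : 0 < u e := lt_of_le_of_ne (hu e) (Ne.symm he)
    rw [← le_div_iff₀ hpos, maxMultiple, dif_pos ⟨e, he'⟩]
    exact Finset.inf'_le (fun e => s e / u e) he'

theorem exists_eq_maxMultiple_mul (h : u ≠ 0) : ∃ e, u e ≠ 0 ∧ s e = maxMultiple s u * u e := by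
  have h' := Finsupp.support_nonempty_iff.2 h
  obtain ⟨e, he, hee⟩ := Finset.exists_mem_eq_inf' h' fun e => s e / u e
  have he := Finsupp.mem_support_iff.1 he
  refine ⟨e, he, ?_⟩
  rw [maxMultiple, dif_pos h', hee, div_mul_cancel₀ _ he]

theorem maxMultiple_pos (hs : 0 ≤ s) (hu : 0 ≤ u) (h : u ≠ 0) (hsu : ∀ e, u e ≠ 0 → s e ≠ 0) :
    0 < maxMultiple s u := by
  obtain ⟨e, he, hee⟩ := exists_eq_maxMultiple_mul (s := s) h
  refine lt_of_le_of_ne (maxMultiple_nonneg hs hu) fun h0 => hsu e he ?_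
  rw [hee, ← h0, zero_mul]

theorem ne_zero_of_maxMultiple_ne_zero (hs : 0 ≤ s) (hu : 0 ≤ u) (h : maxMultiple s u ≠ 0) {e : ι}
    (he : u e ≠ 0) : s e ≠ 0 := by
  have h1 := maxMultiple_mul_le hs hu e
  have h2 : 0 < maxMultiple s u * u e :=
    mul_pos (lt_of_le_of_ne (maxMultiple_nonneg hs hu) (Ne.symm h))
      (lt_of_le_of_ne (hu e) (Ne.symm he))
  exact (h2.trans_le h1).ne'

end MaxMultiple

variable {X : Type*} {S : ConicalComplex X}

/-- The point of the conical complex underlying an element of `|M|`. -/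
abbrev MonoidalComplex.Elem.pt {M : MonoidalComplex S} (y : M.Elem) : X := y.1

/-- The total weight of a coefficient vector. -/
noncomputable abbrev weigh {ι : Type*} (w : ι → ℝ) : (ι →₀ ℝ) →ₗ[ℝ] ℝ :=
  Finsupp.linearCombination ℝ w

theorem weigh_pos {ι : Type*} {w : ι → ℝ} (hw : ∀ e, 0 < w e) {q : ι →₀ ℝ} (hq : 0 ≤ q)
    (h : q ≠ 0) : 0 < weigh w q := by
  rw [Finsupp.linearCombination_apply, Finsupp.sum]
  refine Finset.sum_pos (fun e he => ?_) (Finsupp.support_nonempty_iff.2 h)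
  exact mul_pos (lt_of_le_of_ne (hq e) (Finsupp.mem_support_iff.1 he).symm) (hw e)

/-- A coherent (or regular) triangulation of a monoidal complex, encoded by its optimal conical
combinations: among all representations of a point `p` as a conical combination of the vertices
contained in a face of the complex, `std p` is the unique one of smallest weight. The weights are
generic, which is encoded by a filter on the space of all weight vectors: any finite number of the
strict inequalities that express optimality hold simultaneously for suitable weights. The
faces of the triangulation are the supports of the combinations `std p`. -/
structure Triangulation (M : MonoidalComplex S) where
  verts : Finset M.Elem
  std : X → (M.Elem →₀ ℝ)
  weights : Filter (M.Elem → ℝ)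
  neBot : weights.NeBot
  std_nonneg : ∀ (c : S.faces), ∀ p ∈ (c : Set X), 0 ≤ std p
  std_mem : ∀ (c : S.faces), ∀ p ∈ (c : Set X), ∀ e, std p e ≠ 0 → e ∈ verts
  isComb_std : ∀ (c : S.faces), ∀ p ∈ (c : Set X), S.IsComb c MonoidalComplex.Elem.pt (std p) p
  weights_pos : ∀ᶠ w in weights, ∀ e, 0 < w e
  std_lt : ∀ (c : S.faces) p q, S.IsComb c MonoidalComplex.Elem.pt q p → 0 ≤ q →
    (∀ e, q e ≠ 0 → e ∈ verts) → q ≠ std p → ∀ᶠ w in weights, weigh w (std p) < weigh w q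

namespace Triangulation

open MonoidalComplex

variable {M : MonoidalComplex S} (T : Triangulation M)

/-- A conical combination supported by a face of the triangulation is optimal: otherwise it could be
improved inside of an optimal combination whose support is the whole face. -/
theorem std_eq_of_support {c d : S.faces} {p p' : X} {q : M.Elem →₀ ℝ} (hp : p ∈ (c : Set X))
    (hq : 0 ≤ q) (h : ∀ e, q e ≠ 0 → T.std p e ≠ 0) (hqp : S.IsComb d Elem.pt q p') :
    T.std p' = q := by
  have hs := T.isComb_std c p hp
  have hqp' : S.IsComb c Elem.pt q p' :=
    hqp.transport_of_inFace hq fun e he => hs.1 e (h e he)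
  by_contra hne
  have hne' : q ≠ T.std p' := fun h => hne h.symm
  have hs' := T.isComb_std c p' hqp'.2.1
  have hmem : ∀ e, q e ≠ 0 → e ∈ T.verts := fun e he => T.std_mem c p hp e (h e he)
  have hlt := T.std_lt c p' q hqp' hq hmem hne'
  have hq0 : q ≠ 0 := by
    rintro rfl
    have := T.neBot
    obtain ⟨w, hw, hw'⟩ := (hlt.and T.weights_pos).exists
    have h1 := weigh_pos hw' (T.std_nonneg c p' hqp'.2.1) hne
    rw [map_zero] at hw
    exact lt_asymm hw h1
  have hr := maxMultiple_pos (T.std_nonneg c p hp) hq hq0 h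
  set r := maxMultiple (T.std p) q
  have h2 : S.IsComb c Elem.pt (T.std p + r • (T.std p' - q)) p := by
    refine ⟨hs.1.add ((hs'.1.sub hqp'.1).smul r), hp, ?_⟩
    rw [map_add, map_smul, map_sub, hs'.2.2, hqp'.2.2, hs.2.2]
    simp
  have h3 : 0 ≤ T.std p + r • (T.std p' - q) := by
    intro e
    have := maxMultiple_mul_le (T.std_nonneg c p hp) hq e
    have h4 := mul_nonneg hr.le (T.std_nonneg c p' hqp'.2.1 e)
    simp only [Finsupp.coe_add, Finsupp.coe_smul, Finsupp.coe_sub, Pi.add_apply, Pi.smul_apply,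
      Pi.sub_apply, smul_eq_mul, Finsupp.coe_zero, Pi.zero_apply] at h4 ⊢
    linarith
  have h4 : ∀ e, (T.std p + r • (T.std p' - q)) e ≠ 0 → e ∈ T.verts := by
    intro e he
    by_contra hev
    have h5 : T.std p e = 0 := by_contra fun h => hev (T.std_mem c p hp e h)
    have h6 : T.std p' e = 0 := by_contra fun h => hev (T.std_mem c p' hqp'.2.1 e h)
    have h7 : q e = 0 := by_contra fun h => hev (hmem e h)
    simp [h5, h6, h7] at he
  have h5 : T.std p + r • (T.std p' - q) ≠ T.std p := by
    rw [Ne, add_eq_left, smul_eq_zero, not_or, sub_eq_zero]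
    exact ⟨hr.ne', hne⟩
  have := T.neBot
  obtain ⟨w, hw, hw'⟩ := (hlt.and (T.std_lt c p _ h2 h3 h4 h5)).exists
  rw [map_add, map_smul, map_sub, smul_eq_mul] at hw'
  nlinarith

theorem isComb_single {c : S.faces} (x : M.Elem) (hx : x.1 ∈ (c : Set X)) :
    S.IsComb c Elem.pt (Finsupp.single x 1) x.1 :=
  ⟨InFace.single hx 1, hx, by simp⟩

/-- An element of `|M|` whose optimal combination has coefficients less than `1` is not a vertex of
the triangulation, even if it belongs to `T.verts`. -/
theorem std_apply_eq_zero (x : M.Elem) (hx1 : ∀ e, T.std x.1 e < 1) (c : S.faces) (p : X)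
    (hp : p ∈ (c : Set X)) : T.std p x = 0 := by
  obtain ⟨d, hxd⟩ := x.exists_face
  by_contra h
  have := T.std_eq_of_support (q := Finsupp.single x 1) hp (by simp)
    (fun e he => by
      rcases eq_or_ne x e with rfl | hxe
      · exact h
      · simp [Finsupp.single_eq_of_ne' hxe] at he) (isComb_single x hxd)
  have h1 := hx1 x
  rw [this] at h1
  simp at h1

/-- Stellar subdivision at an element `x` of `|M|`. The new vertex gets a weight which is smaller
than the weight of `std x` by an infinitesimal amount. Therefore an optimal combination uses as much
of `x` as possible. -/
theorem exists_stellar (x : M.Elem) (hx0 : T.std x.1 ≠ 0) (hx1 : ∀ e, T.std x.1 e < 1) :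
    ∃ T' : Triangulation M, ∀ (c : S.faces), ∀ p ∈ (c : Set X), T'.std p = T.std p +
      maxMultiple (T.std p) (T.std x.1) • (Finsupp.single x 1 - T.std x.1) := by
  classical
  obtain ⟨d, hxd⟩ := x.exists_face
  set u := T.std x.1 with hu
  have hu0 : 0 ≤ u := T.std_nonneg d _ hxd
  have hud : S.IsComb d Elem.pt u x.1 := T.isComb_std d _ hxd
  have hxs := T.std_apply_eq_zero x hx1
  have hux : u x = 0 := hxs d _ hxd
  have hle : ∀ (c : S.faces), ∀ p ∈ (c : Set X), ∀ e,
      maxMultiple (T.std p) u * u e ≤ T.std p e :=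
    fun c p hp e => maxMultiple_mul_le (T.std_nonneg c p hp) hu0 e
  have hux' : ∀ (c : S.faces), ∀ p ∈ (c : Set X), maxMultiple (T.std p) u ≠ 0 →
      S.IsComb c Elem.pt u x.1 := by
    intro c p hp h
    refine hud.transport_of_inFace hu0 fun e he => ?_
    exact (T.isComb_std c p hp).1 e
      (ne_zero_of_maxMultiple_ne_zero (T.std_nonneg c p hp) hu0 h he)
  -- replacing `x` by its optimal combination
  have hflat : ∀ (c : S.faces) p q, S.IsComb c Elem.pt q p → 0 ≤ q →
      (∀ e, q e ≠ 0 → e ∈ insert x T.verts) →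
      S.IsComb c Elem.pt (q + q x • (u - Finsupp.single x 1)) p ∧
      0 ≤ q + q x • (u - Finsupp.single x 1) ∧
      ∀ e, (q + q x • (u - Finsupp.single x 1) : M.Elem →₀ ℝ) e ≠ 0 → e ∈ T.verts := by
    intro c p q hq hq0 hqE
    have hval : ∀ e, e ≠ x → (q + q x • (u - Finsupp.single x 1) : M.Elem →₀ ℝ) e = q e + q x * u e := by
      intro e he
      simp [Finsupp.single_eq_of_ne he]
    have hvalx : (q + q x • (u - Finsupp.single x 1) : M.Elem →₀ ℝ) x = 0 := by simp [hux]
    refine ⟨?_, ?_, ?_⟩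
    · by_cases hqx : q x = 0
      · simpa [hqx] using hq
      · have hxc : x.1 ∈ (c : Set X) := hq.1 x hqx
        have huc := hud.transport hu0 hxc
        have hxc' := isComb_single x hxc
        refine ⟨hq.1.add ((huc.1.sub hxc'.1).smul _), hq.2.1, ?_⟩
        rw [map_add, map_smul, map_sub, huc.2.2, hxc'.2.2, hq.2.2]
        simp
    · intro e
      rcases eq_or_ne e x with rfl | he
      · rw [hvalx]; exact le_rfl
      · rw [hval e he]
        exact add_nonneg (hq0 e) (mul_nonneg (hq0 x) (hu0 e))
    · intro e he
      rcases eq_or_ne e x with rfl | hex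
      · exact absurd hvalx he
      · rw [hval e hex] at he
        by_cases hqe : q e = 0
        · rw [hqe, zero_add] at he
          exact T.std_mem d _ hxd e (right_ne_zero_of_mul he)
        · exact (Finset.mem_insert.1 (hqE e hqe)).resolve_left hex
  have hweigh : ∀ (w : M.Elem → ℝ) (ε : ℝ) (q : M.Elem →₀ ℝ),
      weigh (Function.update w x (weigh w u - ε)) q =
        weigh w (q + q x • (u - Finsupp.single x 1)) - ε * q x := by
    intro w ε q
    have h1 : Function.update w x (weigh w u - ε) =
        w + (weigh w u - ε - w x) • Pi.single x (1 : ℝ) := by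
      ext e
      rcases eq_or_ne e x with rfl | he
      · simp
      · simp [he]
    have h2 : ∀ k : ℝ, weigh (w + k • Pi.single x (1 : ℝ)) q = weigh w q + k * q x := by
      intro k
      simp only [Finsupp.linearCombination_apply, Pi.add_apply, Pi.smul_apply, smul_eq_mul, mul_add]
      rw [Finsupp.sum_add]
      congr 1
      rw [Finsupp.sum, Finset.sum_eq_single x]
      · simp [mul_comm]
      · intro e _ he
        simp [he]
      · intro hx
        simp [Finsupp.notMem_support_iff.1 hx]
    rw [h1, h2, map_add, map_smul, map_sub, Finsupp.linearCombination_single]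
    simp only [smul_eq_mul]
    ring
  have hstd : ∀ (c : S.faces), ∀ p ∈ (c : Set X), ∀ e,
      (T.std p + maxMultiple (T.std p) u • (Finsupp.single x 1 - u) : M.Elem →₀ ℝ) e =
        if e = x then maxMultiple (T.std p) u
        else T.std p e - maxMultiple (T.std p) u * u e := by
    intro c p hp e
    split_ifs with he
    · subst he
      simp [hux, hxs c p hp]
    · simp [Finsupp.single_eq_of_ne he]
      ring
  refine ⟨{ verts := insert x T.verts
            std := fun p => T.std p + maxMultiple (T.std p) u • (Finsupp.single x 1 - u)
            weights := T.weights.bind fun w =>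
              (𝓝[>] (0 : ℝ)).map fun ε => Function.update w x (weigh w u - ε)
            neBot := ?_, std_nonneg := ?_, std_mem := ?_, isComb_std := ?_, weights_pos := ?_
            std_lt := ?_ }, fun c p _ => rfl⟩
  · have := T.neBot
    rw [neBot_iff, Ne, ← empty_mem_iff_bot]
    intro h
    have h1 : ∀ᶠ w in T.weights, ∀ᶠ ε in 𝓝[>] (0 : ℝ), False := h
    obtain ⟨w, hw⟩ := h1.exists
    exact hw.exists.elim fun _ h => h
  · intro c p hp e
    rw [hstd c p hp e]
    split_ifs
    · exact maxMultiple_nonneg (T.std_nonneg c p hp) hu0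
    · exact sub_nonneg.2 (hle c p hp e)
  · intro c p hp e he
    rw [hstd c p hp e] at he
    split_ifs at he with hex
    · exact hex ▸ Finset.mem_insert_self _ _
    · refine Finset.mem_insert_of_mem ?_
      by_contra hev
      have h5 : T.std p e = 0 := by_contra fun h => hev (T.std_mem c p hp e h)
      have h6 : u e = 0 := by_contra fun h => hev (T.std_mem d _ hxd e h)
      simp [h5, h6] at he
  · intro c p hp
    have hs := T.isComb_std c p hp
    by_cases h : maxMultiple (T.std p) u = 0
    · simpa [h] using hs
    · have huc := hux' c p hp h
      have hxc' := isComb_single x huc.2.1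
      refine ⟨hs.1.add ((hxc'.1.sub huc.1).smul _), hp, ?_⟩
      rw [map_add, map_smul, map_sub, huc.2.2, hxc'.2.2, hs.2.2]
      simp
  · refine Filter.eventually_bind.2 ?_
    filter_upwards [T.weights_pos] with w hw
    rw [eventually_map]
    have h1 : ∀ᶠ ε in 𝓝[>] (0 : ℝ), ε < weigh w u :=
      (eventually_lt_nhds (weigh_pos hw hu0 hx0)).filter_mono nhdsWithin_le_nhds
    filter_upwards [h1] with ε hε e
    rcases eq_or_ne e x with rfl | he
    · simpa using hε
    · simpa [he] using hw e
  · intro c p q hq hq0 hqE hne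
    obtain ⟨hf1, hf2, hf3⟩ := hflat c p q hq hq0 hqE
    set f := q + q x • (u - Finsupp.single x 1) with hf
    have hs : ∀ (w : M.Elem → ℝ) (ε : ℝ), weigh (Function.update w x (weigh w u - ε))
        (T.std p + maxMultiple (T.std p) u • (Finsupp.single x 1 - u)) =
        weigh w (T.std p) - ε * maxMultiple (T.std p) u := by
      intro w ε
      rw [hweigh, hstd c p hq.2.1 x, if_pos rfl]
      congr 2
      module
    simp only [Filter.eventually_bind, eventually_map, hs, hweigh]
    by_cases hfs : f = T.std p
    · have hq' : q = T.std p + q x • (Finsupp.single x 1 - u) := by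
        rw [← hfs, hf]
        module
      have h1 : q x < maxMultiple (T.std p) u := by
        obtain ⟨e, he, hee⟩ := exists_eq_maxMultiple_mul (s := T.std p) hx0
        have hex : e ≠ x := by
          rintro rfl
          exact he hux
        have h2 : q e = T.std p e - q x * u e := by
          conv_lhs => rw [hq']
          simp [Finsupp.single_eq_of_ne hex]
          ring
        have h3 := hq0 e
        rw [h2, hee] at h3
        have h4 : 0 < u e := lt_of_le_of_ne (hu0 e) (Ne.symm he)
        have h5 : q x ≤ maxMultiple (T.std p) u := by
          by_contra hlt
          rw [not_le] at hlt
          have := mul_lt_mul_of_pos_right hlt h4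
          change 0 ≤ maxMultiple (T.std p) u * u e - q x * u e at h3
          linarith
        refine lt_of_le_of_ne h5 fun h6 => hne ?_
        rw [← h6]
        exact hq'
      refine Eventually.of_forall fun w => ?_
      filter_upwards [self_mem_nhdsWithin] with ε hε
      rw [← hf, hfs]
      have := mul_lt_mul_of_pos_left h1 (Set.mem_Ioi.1 hε)
      linarith
    · filter_upwards [T.std_lt c p f hf1 hf2 hf3 hfs] with w hw
      have h1 : ContinuousAt (fun ε : ℝ => weigh w f - ε * q x -
          (weigh w (T.std p) - ε * maxMultiple (T.std p) u)) 0 := by fun_prop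
      have h2 := h1.tendsto.eventually (lt_mem_nhds (a := 0) (by simpa using hw))
      filter_upwards [h2.filter_mono nhdsWithin_le_nhds] with ε hε
      linarith

end Triangulation

/-! ### Multiplicities and unimodular triangulations -/

namespace Triangulation

open MonoidalComplex

variable {M : MonoidalComplex S} (T : Triangulation M)

/-- The faces of a triangulation, given by their sets of vertices. -/
def IsFace (F : Finset M.Elem) : Prop :=
  ∃ c : S.faces, ∃ p ∈ (c : Set X), F = (T.std p).support

/-- The elements of `|M|` in the half-open parallelepiped spanned by the vertices of a face. If `M`
is normal, their number is the multiplicity of the face. -/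
def box (F : Finset M.Elem) : Set M.Elem :=
  {y | (∀ e, T.std y.1 e ≠ 0 → e ∈ F) ∧ ∀ e, T.std y.1 e < 1}

theorem std_injective {y z : M.Elem} (h : T.std y.1 = T.std z.1) : y = z := by
  obtain ⟨c, hc⟩ := y.exists_face
  obtain ⟨d, hd⟩ := z.exists_face
  have h1 := T.isComb_std c _ hc
  rw [h] at h1
  exact Subtype.ext (h1.unique (T.isComb_std d _ hd) (T.std_nonneg d _ hd))

theorem finite_lt_one : {y : M.Elem | ∀ e, T.std y.1 e < 1}.Finite := by
  have := S.finite_faces.to_subtype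
  have h : {y : M.Elem | ∀ e, T.std y.1 e < 1} ⊆
      ⋃ c : S.faces, {y | y.1 ∈ (c : Set X) ∧ ∀ e, T.std y.1 e < 1} := by
    intro y hy
    obtain ⟨c, hc⟩ := y.exists_face
    exact Set.mem_iUnion.2 ⟨c, hc, hy⟩
  refine (Set.finite_iUnion fun c => ?_).subset h
  refine Set.Finite.of_finite_image
    ((finite_bounded_integral fun i => ∑ e ∈ T.verts, |S.coord c e.1 i|).subset ?_)
    (f := fun y => S.coord c y.1)
    fun y hy z hz hyz => Subtype.ext (coord_injOn hy.1 hz.1 hyz)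
  rintro _ ⟨y, ⟨hy, hy1⟩, rfl⟩
  refine ⟨M.integral c _ (coord_mem_monoid y hy), fun i => ?_⟩
  beta_reduce
  rw [← (T.isComb_std c _ hy).2.2, comb_apply, Finsupp.sum, Finset.sum_apply]
  refine (Finset.abs_sum_le_sum_abs _ _).trans ?_
  refine (Finset.sum_le_sum fun e _ => ?_).trans
    (Finset.sum_le_sum_of_subset_of_nonneg (t := T.verts)
      (fun e he => T.std_mem c _ hy e (Finsupp.mem_support_iff.1 he)) fun e _ _ => abs_nonneg _)
  rw [Pi.smul_apply, smul_eq_mul, abs_mul, abs_of_nonneg (T.std_nonneg c _ hy e)]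
  exact mul_le_of_le_one_left (abs_nonneg _) (hy1 e).le

theorem finite_box (F : Finset M.Elem) : (T.box F).Finite :=
  T.finite_lt_one.subset fun _ hy => hy.2

theorem finite_isFace : {F | T.IsFace F}.Finite := by
  refine (T.verts.powerset.finite_toSet).subset ?_
  rintro F ⟨c, p, hp, rfl⟩
  exact Finset.mem_coe.2 (Finset.mem_powerset.2 fun e he =>
    T.std_mem c p hp e (Finsupp.mem_support_iff.1 he))

/-- In a normal monoidal complex we can replace the coefficients of an optimal combination by
their fractional parts. -/
theorem exists_fract (hM : ∀ c : S.faces, IsNormalMonoid (M.monoid c)) (y : M.Elem) :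
    ∃ y' : M.Elem, ∀ e, T.std y'.1 e = Int.fract (T.std y.1 e) := by
  obtain ⟨c, hc⟩ := y.exists_face
  have hy := T.isComb_std c _ hc
  set q : M.Elem →₀ ℝ := (T.std y.1).mapRange Int.fract Int.fract_zero with hq
  have hq0 : 0 ≤ q := fun e => by simp [hq, Int.fract_nonneg]
  have hqs : ∀ e, q e ≠ 0 → T.std y.1 e ≠ 0 := by
    intro e he h
    simp [hq, h] at he
  have hqc : S.InFace c Elem.pt q := fun e he => hy.1 e (hqs e he)
  have hmem : S.comb c Elem.pt q ∈ M.monoid c := by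
    have h1 : S.comb c Elem.pt q ∈ AddSubgroup.closure (M.monoid c : Set (Fin (S.dim c) → ℝ)) := by
      have h2 : S.comb c Elem.pt q = S.coord c y.1 -
          ∑ e ∈ (T.std y.1).support, ⌊T.std y.1 e⌋ • S.coord c e.1 := by
        rw [← hy.2.2, comb_apply, comb_apply,
          Finsupp.sum_of_support_subset q (s := (T.std y.1).support)
          (fun e he => Finsupp.mem_support_iff.2 (hqs e (Finsupp.mem_support_iff.1 he)))
          (fun e r => r • S.coord c e.pt) (fun _ _ => zero_smul _ _), Finsupp.sum, ← Finset.sum_sub_distrib]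
        refine Finset.sum_congr rfl fun e _ => ?_
        rw [← Int.cast_smul_eq_zsmul ℝ, ← sub_smul]
        rfl
      rw [h2]
      refine sub_mem (AddSubgroup.subset_closure (coord_mem_monoid y hc)) (sum_mem fun e he => ?_)
      exact zsmul_mem (AddSubgroup.subset_closure
        (coord_mem_monoid e (hy.1 e (Finsupp.mem_support_iff.1 he)))) _
    have h3 := hM c
    rw [IsNormalMonoid, M.hull_monoid] at h3
    rw [← SetLike.mem_coe, h3]
    exact ⟨h1, hqc.comb_mem hq0⟩
  obtain ⟨y', -, -, hy'⟩ := exists_elem hmem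
  refine ⟨y', fun e => ?_⟩
  rw [hy', T.std_eq_of_support hc hq0 hqs (hqc.isComb hq0)]
  simp [hq]

section Stellar

variable {T} {T' : Triangulation M} {x : M.Elem} (hx0 : T.std x.1 ≠ 0)
  (hx1 : ∀ e, T.std x.1 e < 1)
  (hT' : ∀ (c : S.faces), ∀ p ∈ (c : Set X), T'.std p = T.std p +
      maxMultiple (T.std p) (T.std x.1) • (Finsupp.single x 1 - T.std x.1))

include hx1 hT'

theorem stellar_apply_self (c : S.faces) (p : X) (hp : p ∈ (c : Set X)) :
    T'.std p x = maxMultiple (T.std p) (T.std x.1) := by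
  obtain ⟨d, hd⟩ := x.exists_face
  rw [hT' c p hp]
  simp [T.std_apply_eq_zero x hx1 c p hp, T.std_apply_eq_zero x hx1 d _ hd]

theorem stellar_apply (c : S.faces) (p : X) (hp : p ∈ (c : Set X)) (e : M.Elem) (he : e ≠ x) :
    T.std p e = T'.std p e + T'.std p x * T.std x.1 e := by
  rw [stellar_apply_self hx1 hT' c p hp, hT' c p hp]
  simp [Finsupp.single_eq_of_ne he]

theorem stellar_eq_self (c : S.faces) (p : X) (hp : p ∈ (c : Set X)) (h : T'.std p x = 0) :
    T'.std p = T.std p := by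
  rw [stellar_apply_self hx1 hT' c p hp] at h
  rw [hT' c p hp, h, zero_smul, add_zero]

include hx0

theorem exists_stellar_apply_eq_zero (c : S.faces) (p : X) (hp : p ∈ (c : Set X)) :
    ∃ e, T.std x.1 e ≠ 0 ∧ e ≠ x ∧ T'.std p e = 0 := by
  obtain ⟨d, hd⟩ := x.exists_face
  obtain ⟨e, he, hee⟩ := exists_eq_maxMultiple_mul (s := T.std p) hx0
  have hex : e ≠ x := by
    rintro rfl
    exact he (T.std_apply_eq_zero e hx1 d _ hd)
  refine ⟨e, he, hex, ?_⟩
  rw [stellar_apply hx1 hT' c p hp e hex, stellar_apply_self hx1 hT' c p hp] at hee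
  linarith

/-- A face of a stellar subdivision that does not contain the new vertex is a face of the original
triangulation, with the same multiplicity. -/
theorem isFace_of_stellar {F : Finset M.Elem} (hF : T'.IsFace F) (hxF : x ∉ F) :
    T.IsFace F ∧ T'.box F = T.box F ∧ ∃ e, T.std x.1 e ≠ 0 ∧ e ∉ F := by
  obtain ⟨c, p, hp, rfl⟩ := hF
  obtain ⟨e, he, hex, he0⟩ := exists_stellar_apply_eq_zero hx0 hx1 hT' c p hp
  have heF : e ∉ (T'.std p).support := by simpa using he0
  refine ⟨⟨c, p, hp, ?_⟩, ?_, e, he, heF⟩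
  · rw [stellar_eq_self hx1 hT' c p hp (Finsupp.notMem_support_iff.1 hxF)]
  · ext y
    obtain ⟨d, hd⟩ := y.exists_face
    have h1 : (∀ e, T'.std y.1 e ≠ 0 → e ∈ (T'.std p).support) → T'.std y.1 = T.std y.1 :=
      fun h => stellar_eq_self hx1 hT' d _ hd (by_contra fun h0 => hxF (h x h0))
    have h2 : (∀ e, T.std y.1 e ≠ 0 → e ∈ (T'.std p).support) → T'.std y.1 = T.std y.1 := by
      refine fun h => stellar_eq_self hx1 hT' d _ hd (by_contra fun h0 => ?_)
      rw [stellar_apply_self hx1 hT' d _ hd] at h0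
      obtain ⟨d', hd'⟩ := x.exists_face
      exact heF (h e (ne_zero_of_maxMultiple_ne_zero (T.std_nonneg d _ hd)
        (T.std_nonneg d' _ hd') h0 he))
    constructor
    · intro h
      simpa [box, h1 h.1] using h
    · intro h
      simpa [box, h2 h.1] using h

/-- A face of a stellar subdivision that contains the new vertex has smaller multiplicity than some
face of the original triangulation: taking fractional parts of the coefficients with respect to the
original vertices is an injective map between the parallelepipeds, which does not reach the new
vertex. -/
theorem exists_ncard_box_lt_of_stellar (hM : ∀ c : S.faces, IsNormalMonoid (M.monoid c))
    {F : Finset M.Elem} (hF : T'.IsFace F) (hxF : x ∈ F) :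
    ∃ G, T.IsFace G ∧ (T'.box F).ncard < (T.box G).ncard := by
  obtain ⟨c, p, hp, rfl⟩ := hF
  obtain ⟨d, hd⟩ := x.exists_face
  have hu0 := T.std_nonneg d _ hd
  obtain ⟨e₀, he₀, hex₀, he₀0⟩ := exists_stellar_apply_eq_zero hx0 hx1 hT' c p hp
  have hxp : T'.std p x ≠ 0 := Finsupp.mem_support_iff.1 hxF
  have hxp' := hxp
  rw [stellar_apply_self hx1 hT' c p hp] at hxp'
  have huG : ∀ e, T.std x.1 e ≠ 0 → T.std p e ≠ 0 := fun e he =>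
    ne_zero_of_maxMultiple_ne_zero (T.std_nonneg c p hp) hu0 hxp' he
  refine ⟨_, ⟨c, p, hp, rfl⟩, ?_⟩
  choose f hf using T.exists_fract hM
  have hz : ∀ z ∈ T'.box (T'.std p).support, 0 ≤ T'.std z.1 ∧ T'.std z.1 x < 1 ∧
      T.std z.1 x = 0 ∧ T.std z.1 e₀ = T'.std z.1 x * T.std x.1 e₀ ∧
      ∀ e, e ≠ x → T.std z.1 e = T'.std z.1 e + T'.std z.1 x * T.std x.1 e := by
    intro z hz
    obtain ⟨d', hd'⟩ := z.exists_face
    refine ⟨T'.std_nonneg d' _ hd', hz.2 x, T.std_apply_eq_zero x hx1 d' _ hd', ?_,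
      stellar_apply hx1 hT' d' _ hd'⟩
    rw [stellar_apply hx1 hT' d' _ hd' _ hex₀, add_eq_right]
    by_contra h
    exact Finsupp.mem_support_iff.1 (hz.1 _ h) he₀0
  have hpos : 0 < T.std x.1 e₀ := lt_of_le_of_ne (hu0 e₀) (Ne.symm he₀)
  have hfract : ∀ z ∈ T'.box (T'.std p).support,
      T.std (f z).1 e₀ = T'.std z.1 x * T.std x.1 e₀ := by
    intro z hzF
    obtain ⟨h1, h2, h3, h4, h5⟩ := hz z hzF
    rw [hf, h4, Int.fract_eq_self]
    exact ⟨mul_nonneg (h1 x) hpos.le, mul_lt_one_of_nonneg_of_lt_one_left (h1 x) h2 (hx1 _).le⟩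
  have hinj : Set.InjOn f (T'.box (T'.std p).support) := by
    intro z hzF z' hzF' hzz
    obtain ⟨h1, h2, h3, h4, h5⟩ := hz z hzF
    obtain ⟨h1', h2', h3', h4', h5'⟩ := hz z' hzF'
    have hx : T'.std z.1 x = T'.std z'.1 x := by
      have := hfract z hzF
      rw [hzz, hfract z' hzF'] at this
      exact (mul_right_cancel₀ he₀ this).symm
    refine T'.std_injective (Finsupp.ext fun e => ?_)
    rcases eq_or_ne e x with rfl | he
    · exact hx
    · have h6 : Int.fract (T.std z.1 e) = Int.fract (T.std z'.1 e) := by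
        rw [← hf, ← hf, hzz]
      rw [h5 e he, h5' e he, hx, Int.fract_eq_fract] at h6
      obtain ⟨k, hk⟩ := h6
      rw [add_sub_add_right_eq_sub] at hk
      have h7 := hzF.2 e
      have h8 := hzF'.2 e
      have h9 : (0 : ℝ) ≤ T'.std z.1 e := h1 e
      have h10 : (0 : ℝ) ≤ T'.std z'.1 e := h1' e
      have h11 : (k : ℝ) < 1 := by linarith
      have h12 : (-1 : ℝ) < k := by linarith
      have h13 : k < 1 := by exact_mod_cast h11
      have h14 : -1 < k := by exact_mod_cast h12
      obtain rfl : k = 0 := by omega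
      rw [Int.cast_zero] at hk
      linarith
  rw [← hinj.ncard_image]
  refine Set.ncard_lt_ncard ⟨?_, fun h => ?_⟩ (T.finite_box _)
  · rintro _ ⟨z, hzF, rfl⟩
    obtain ⟨h1, h2, h3, h4, h5⟩ := hz z hzF
    refine ⟨fun e he => Finsupp.mem_support_iff.2 ?_, fun e => ?_⟩
    · rw [hf] at he
      have hze : T.std z.1 e ≠ 0 := fun h => he (by rw [h, Int.fract_zero])
      have hex : e ≠ x := by
        rintro rfl
        exact hze h3
      by_cases hu : T.std x.1 e = 0
      · rw [h5 e hex, hu, mul_zero, add_zero] at hze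
        have h6 := Finsupp.mem_support_iff.1 (hzF.1 e hze)
        rwa [stellar_apply hx1 hT' c p hp e hex, hu, mul_zero, add_zero]
      · exact huG e hu
    · rw [hf]
      exact Int.fract_lt_one _
  · obtain ⟨z, hzF, hzx⟩ := h (show x ∈ T.box (T.std p).support from
      ⟨fun e he => Finsupp.mem_support_iff.2 (huG e he), hx1⟩)
    have h1 := hfract z hzF
    rw [hzx] at h1
    have h2 := (hz z hzF).2.1
    nlinarith

end Stellar

theorem exists_nat_of_ncard_box_le_one (hM : ∀ c : S.faces, IsNormalMonoid (M.monoid c))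
    (h : ∀ F, T.IsFace F → (T.box F).ncard ≤ 1) (y : M.Elem) (e : M.Elem) :
    ∃ k : ℕ, T.std y.1 e = k := by
  obtain ⟨c, hc⟩ := y.exists_face
  obtain ⟨z, -, hz, hz'⟩ := exists_elem (M.monoid c).zero_mem
  have hz0 : T.std z.1 = 0 := by
    have h1 : S.IsComb c Elem.pt (0 : M.Elem →₀ ℝ) z.1 :=
      ⟨fun _ h => absurd rfl h, hz' ▸ chart_mem (zero_mem _), by rw [hz, map_zero]⟩
    exact T.std_eq_of_support hc le_rfl (fun _ h => absurd rfl h) h1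
  obtain ⟨y', hy'⟩ := T.exists_fract hM y
  have h1 := h _ ⟨c, _, hc, rfl⟩
  rw [Set.ncard_le_one_iff (T.finite_box _)] at h1
  have h2 : y' = z := by
    refine h1 ⟨fun e he => Finsupp.mem_support_iff.2 fun h0 => he ?_, fun e => ?_⟩
      ⟨fun e he => ?_, fun e => ?_⟩
    · rw [hy', h0, Int.fract_zero]
    · rw [hy']
      exact Int.fract_lt_one _
    · rw [hz0] at he
      exact absurd rfl he
    · rw [hz0]
      exact zero_lt_one
  have h3 := hy' e
  rw [h2, hz0] at h3
  obtain ⟨k, hk⟩ := Int.fract_eq_zero_iff.1 h3.symm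
  have h4 : (0 : ℝ) ≤ T.std y.1 e := T.std_nonneg c _ hc e
  rw [← hk] at h4
  lift k to ℕ using by exact_mod_cast h4
  exact ⟨k, by rw [← hk, Int.cast_natCast]⟩

/-- A coherent triangulation of a normal monoidal complex can be refined to a unimodular one:
a stellar subdivision at an element of the parallelepiped of a face of maximal multiplicity reduces
the number of these faces. -/
theorem exists_unimodular (hM : ∀ c : S.faces, IsNormalMonoid (M.monoid c))
    (T : Triangulation M) :
    ∃ T' : Triangulation M, ∀ y e : M.Elem, ∃ k : ℕ, T'.std y.1 e = k := by
  have key : ∀ (m k : ℕ) (T : Triangulation M), (∀ F, T.IsFace F → (T.box F).ncard ≤ m + 1) →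
      {F | T.IsFace F ∧ (T.box F).ncard = m + 1}.ncard ≤ k →
      ∃ T' : Triangulation M, ∀ y e : M.Elem, ∃ k : ℕ, T'.std y.1 e = k := by
    intro m
    induction m with
    | zero => exact fun k T h _ => ⟨T, T.exists_nat_of_ncard_box_le_one hM h⟩
    | succ m ihm =>
      intro k
      induction k with
      | zero =>
        intro T h hk
        refine ihm _ T (fun F hF => ?_) le_rfl
        refine Nat.lt_succ_iff.1 (lt_of_le_of_ne (h F hF) fun heq => ?_)
        rw [Nat.le_zero, Set.ncard_eq_zero (T.finite_isFace.subset fun _ h => h.1)] at hk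
        exact (hk ▸ (show F ∈ {F | T.IsFace F ∧ (T.box F).ncard = m + 1 + 1} from ⟨hF, heq⟩) :
          F ∈ (∅ : Set (Finset M.Elem)))
      | succ k ihk =>
        intro T h hk
        by_cases hex : ∃ F, T.IsFace F ∧ (T.box F).ncard = m + 1 + 1
        · obtain ⟨F, hF, hFm⟩ := hex
          obtain ⟨x, hx, hx0⟩ : ∃ x ∈ T.box F, T.std x.1 ≠ 0 := by
            by_contra! hcon
            have : (T.box F).ncard ≤ 1 := by
              rw [Set.ncard_le_one_iff (T.finite_box _)]
              intro a b ha hb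
              exact T.std_injective ((hcon a ha).trans (hcon b hb).symm)
            omega
          obtain ⟨T', hT'⟩ := T.exists_stellar x hx0 hx.2
          refine ihk T' (fun F' hF' => ?_) ?_
          · by_cases hxF' : x ∈ F'
            · obtain ⟨G, hG, hlt⟩ := exists_ncard_box_lt_of_stellar hx0 hx.2 hT' hM hF' hxF'
              exact hlt.le.trans (h G hG)
            · obtain ⟨h1, h2, -⟩ := isFace_of_stellar hx0 hx.2 hT' hF' hxF'
              rw [h2]
              exact h F' h1
          · refine Nat.lt_succ_iff.1 (lt_of_lt_of_le (Set.ncard_lt_ncard ⟨?_, fun hsub => ?_⟩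
              (T.finite_isFace.subset fun _ h => h.1)) hk)
            · rintro F' ⟨hF', hF'm⟩
              by_cases hxF' : x ∈ F'
              · obtain ⟨G, hG, hlt⟩ := exists_ncard_box_lt_of_stellar hx0 hx.2 hT' hM hF' hxF'
                have := h G hG
                omega
              · obtain ⟨h1, h2, -⟩ := isFace_of_stellar hx0 hx.2 hT' hF' hxF'
                exact ⟨h1, h2 ▸ hF'm⟩
            · obtain ⟨hF', hF'm⟩ := hsub (show F ∈ _ from ⟨hF, hFm⟩)
              by_cases hxF' : x ∈ F
              · obtain ⟨G, hG, hlt⟩ := exists_ncard_box_lt_of_stellar hx0 hx.2 hT' hM hF' hxF'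
                have := h G hG
                omega
              · obtain ⟨-, -, e, he, heF⟩ := isFace_of_stellar hx0 hx.2 hT' hF' hxF'
                exact heF (hx.1 e he)
        · refine ihm _ T (fun F hF => ?_) le_rfl
          exact Nat.lt_succ_iff.1 (lt_of_le_of_ne (h F hF) fun heq => hex ⟨F, hF, heq⟩)
  refine key {y : M.Elem | ∀ e, T.std y.1 e < 1}.ncard _ T (fun F _ => ?_) le_rfl
  exact (Set.ncard_le_ncard (fun y hy => hy.2) T.finite_lt_one).trans (Nat.le_succ _)

end Triangulation

/-! ### Existence of a coherent triangulation -/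

theorem Polynomial.eventually_eval_pos {P : Polynomial ℝ} (hP : 0 < P.leadingCoeff) :
    ∀ᶠ x in atTop, 0 < P.eval x := by
  have hP0 : P ≠ 0 := by
    rintro rfl
    simp at hP
  have h1 := (Polynomial.X * P).tendsto_atTop_of_leadingCoeff_nonneg
    (by rw [Polynomial.degree_mul, Polynomial.degree_X, Polynomial.degree_eq_natDegree hP0]
        exact_mod_cast Nat.succ_pos' (n := 0 + P.natDegree) |>.trans_le (by omega))
    (by simpa using hP.le)
  filter_upwards [h1.eventually_gt_atTop 0, eventually_gt_atTop 0] with x hx hx0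
  rw [Polynomial.eval_mul, Polynomial.eval_X] at hx
  exact pos_of_mul_pos_right hx hx0.le

/-- The weights `N ^ i`, `N → ∞`, for different exponents `i`, are generic. -/
theorem eventually_weigh_pow_pos_or_neg {ι : Type*} {idx : ι → ℕ} {r : ι →₀ ℝ} (hr : r ≠ 0)
    (hidx : Set.InjOn idx r.support) :
    (∀ᶠ N : ℝ in atTop, 0 < weigh (fun e => N ^ idx e) r) ∨
      ∀ᶠ N : ℝ in atTop, weigh (fun e => N ^ idx e) r < 0 := by
  classical
  set P : Polynomial ℝ := ∑ e ∈ r.support, Polynomial.monomial (idx e) (r e) with hP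
  have heval : ∀ N : ℝ, weigh (fun e => N ^ idx e) r = P.eval N := by
    intro N
    simp [hP, Finsupp.linearCombination_apply, Finsupp.sum, Polynomial.eval_finsetSum]
  have hP0 : P ≠ 0 := by
    obtain ⟨e, he⟩ := Finsupp.support_nonempty_iff.2 hr
    intro h0
    have h1 : P.coeff (idx e) = r e := by
      rw [hP, Polynomial.finsetSum_coeff, Finset.sum_eq_single e]
      · simp
      · intro e' he' hne
        rw [Polynomial.coeff_monomial, if_neg fun h => hne (hidx he' he h)]
      · exact fun h => absurd he h
    rw [h0, Polynomial.coeff_zero] at h1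
    exact Finsupp.mem_support_iff.1 he h1.symm
  simp only [heval]
  rcases lt_or_gt_of_ne (Polynomial.leadingCoeff_ne_zero.2 hP0) with h | h
  · right
    have := Polynomial.eventually_eval_pos (P := -P) (by simpa using h)
    filter_upwards [this] with x hx
    simpa using hx
  · exact Or.inl (Polynomial.eventually_eval_pos h)

theorem Finset.exists_least_of_trichotomous {α : Type*} {R : α → α → Prop}
    (htrans : ∀ a b c, R a b → R b c → R a c) (s : Finset α) (hs : s.Nonempty)
    (htri : ∀ a ∈ s, ∀ b ∈ s, a = b ∨ R a b ∨ R b a) : ∃ m ∈ s, ∀ b ∈ s, b = m ∨ R m b := by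
  classical
  induction hs using Finset.Nonempty.cons_induction with
  | singleton a => exact ⟨a, by simp⟩
  | cons a s ha hs ih =>
    obtain ⟨m, hm, hmin⟩ := ih fun a ha b hb => htri a (mem_cons_of_mem ha) b (mem_cons_of_mem hb)
    rcases htri a (mem_cons_self _ _) m (mem_cons_of_mem hm) with rfl | h | h
    · exact absurd hm ha
    · refine ⟨a, mem_cons_self _ _, fun b hb => ?_⟩
      rcases mem_cons.1 hb with rfl | hb
      · exact Or.inl rfl
      · rcases hmin b hb with rfl | hb
        · exact Or.inr h
        · exact Or.inr (htrans _ _ _ h hb)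
    · refine ⟨m, mem_cons_of_mem hm, fun b hb => ?_⟩
      rcases mem_cons.1 hb with rfl | hb
      · exact Or.inr h
      · exact hmin b hb

namespace MonoidalComplex

theorem exists_finset_generating (M : MonoidalComplex S) :
    ∃ E : Finset M.Elem, ∀ c, ∃ s : Set (Fin (S.dim c) → ℝ), AddSubmonoid.closure s = M.monoid c ∧
      ∀ x ∈ s, ∃ e ∈ E, e.1 = S.chart c x := by
  have := S.finite_faces.to_subtype
  choose s hs using fun c => M.monoid_fg c
  have hfin : {y : M.Elem | ∃ c, ∃ x ∈ s c, y.1 = S.chart c x}.Finite := by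
    refine Set.Finite.of_finite_image (f := fun y => y.1) ?_ fun y _ z _ h => Subtype.ext h
    refine (Set.finite_iUnion fun c => (s c).finite_toSet.image (S.chart c)).subset ?_
    rintro _ ⟨y, ⟨c, x, hx, hy⟩, rfl⟩
    exact Set.mem_iUnion.2 ⟨c, x, hx, hy.symm⟩
  refine ⟨hfin.toFinset, fun c => ⟨s c, hs c, fun x hx => ?_⟩⟩
  have hxM : x ∈ M.monoid c := hs c ▸ AddSubmonoid.subset_closure hx
  obtain ⟨y, -, -, hy⟩ := exists_elem hxM
  exact ⟨y, hfin.mem_toFinset.2 ⟨c, x, hx, hy⟩, hy⟩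

/-- All points of a face are conical combinations of generators of the monoid. -/
theorem exists_isComb_of_generating {M : MonoidalComplex S} {E : Finset M.Elem} {c : S.faces}
    {s : Set (Fin (S.dim c) → ℝ)} (hs : AddSubmonoid.closure s = M.monoid c)
    (hE : ∀ x ∈ s, ∃ e ∈ E, e.1 = S.chart c x) {p : X} (hp : p ∈ (c : Set X)) :
    ∃ q : M.Elem →₀ ℝ, S.IsComb c Elem.pt q p ∧ 0 ≤ q ∧ ∀ e, q e ≠ 0 → e ∈ E := by
  have key : ∀ v ∈ S.cone c, ∃ q : M.Elem →₀ ℝ, S.InFace c Elem.pt q ∧ S.comb c Elem.pt q = v ∧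
      0 ≤ q ∧ ∀ e, q e ≠ 0 → e ∈ E := by
    have hadd : ∀ v v', (∃ q : M.Elem →₀ ℝ, S.InFace c Elem.pt q ∧ S.comb c Elem.pt q = v ∧
        0 ≤ q ∧ ∀ e, q e ≠ 0 → e ∈ E) → (∃ q : M.Elem →₀ ℝ, S.InFace c Elem.pt q ∧
        S.comb c Elem.pt q = v' ∧ 0 ≤ q ∧ ∀ e, q e ≠ 0 → e ∈ E) →
        ∃ q : M.Elem →₀ ℝ, S.InFace c Elem.pt q ∧ S.comb c Elem.pt q = v + v' ∧
        0 ≤ q ∧ ∀ e, q e ≠ 0 → e ∈ E := by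
      rintro v v' ⟨q, h1, h2, h3, h4⟩ ⟨q', h1', h2', h3', h4'⟩
      refine ⟨q + q', h1.add h1', by rw [map_add, h2, h2'], add_nonneg h3 h3', fun e he => ?_⟩
      by_cases h0 : q e = 0
      · exact h4' e fun h0' => he (by simp [h0, h0'])
      · exact h4 e h0
    have hzero : ∃ q : M.Elem →₀ ℝ, S.InFace c Elem.pt q ∧ S.comb c Elem.pt q = 0 ∧
        0 ≤ q ∧ ∀ e, q e ≠ 0 → e ∈ E :=
      ⟨0, fun _ h => absurd rfl h, map_zero _, le_rfl, fun _ h => absurd rfl h⟩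
    intro v hv
    rw [← M.hull_monoid c] at hv
    induction hv using Submodule.span_induction with
    | zero => exact hzero
    | add x y _ _ hx hy => exact hadd x y hx hy
    | smul r x _ hx =>
      obtain ⟨q, h1, h2, h3, h4⟩ := hx
      refine ⟨(r : ℝ) • q, h1.smul _, by rw [map_smul, h2]; rfl, smul_nonneg r.2 h3,
        fun e he => h4 e fun h0 => he (by simp [h0])⟩
    | mem x hx =>
      rw [SetLike.mem_coe, ← hs] at hx
      induction hx using AddSubmonoid.closure_induction with
      | zero => exact hzero
      | add x y _ _ hx hy => exact hadd x y hx hy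
      | mem x hx =>
        have hxc : x ∈ S.cone c := M.monoid_le (hs ▸ AddSubmonoid.subset_closure hx)
        obtain ⟨e, he, hex⟩ := hE x hx
        have hec : e.1 ∈ (c : Set X) := hex ▸ chart_mem hxc
        refine ⟨Finsupp.single e 1, InFace.single hec 1, ?_, by simp, fun e' he' => ?_⟩
        · rw [comb_single, one_smul, Elem.pt, hex, coord_chart hxc]
        · rcases eq_or_ne e e' with rfl | h
          · exact he
          · simp [Finsupp.single_eq_of_ne' h] at he'
  obtain ⟨q, h1, h2, h3, h4⟩ := key _ (coord_mem hp)
  exact ⟨q, ⟨h1, hp, h2⟩, h3, h4⟩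

/-- Every representation of `p` as a conical combination can be transformed, without increasing the
weight, into one by linearly independent vectors. -/
theorem exists_independent_le {M : MonoidalComplex S} {E : Finset M.Elem} {idx : M.Elem → ℕ}
    (hidx : Set.InjOn idx E) {c : S.faces} {p : X} (q : M.Elem →₀ ℝ)
    (hq : S.IsComb c Elem.pt q p) (hq0 : 0 ≤ q) (hqE : ∀ e, q e ≠ 0 → e ∈ E) :
    ∃ q' : M.Elem →₀ ℝ, (S.IsComb c Elem.pt q' p ∧ 0 ≤ q' ∧ (∀ e, q' e ≠ 0 → e ∈ E) ∧
      ∀ r : M.Elem →₀ ℝ, (∀ e, r e ≠ 0 → q' e ≠ 0) → S.comb c Elem.pt r = 0 → r = 0) ∧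
      (q = q' ∨ ∀ᶠ N : ℝ in atTop,
        weigh (fun e => N ^ idx e) q' < weigh (fun e => N ^ idx e) q) := by
  induction hn : q.support.card using Nat.strong_induction_on generalizing q with
  | _ n ih =>
  by_cases hind : ∀ r : M.Elem →₀ ℝ, (∀ e, r e ≠ 0 → q e ≠ 0) → S.comb c Elem.pt r = 0 → r = 0
  · exact ⟨q, ⟨hq, hq0, hqE, hind⟩, Or.inl rfl⟩
  push Not at hind
  -- a linear relation of positive weight
  obtain ⟨r, hrq, hr0, hrN⟩ : ∃ r : M.Elem →₀ ℝ, (∀ e, r e ≠ 0 → q e ≠ 0) ∧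
      S.comb c Elem.pt r = 0 ∧ ∀ᶠ N : ℝ in atTop, 0 < weigh (fun e => N ^ idx e) r := by
    obtain ⟨r, hrq, hr0, hr⟩ := hind
    rcases eventually_weigh_pow_pos_or_neg hr (idx := idx) (hidx.mono fun e he =>
      hqE e (hrq e (Finsupp.mem_support_iff.1 he))) with h | h
    · exact ⟨r, hrq, hr0, h⟩
    · exact ⟨-r, by simpa using hrq, by rw [map_neg, hr0, neg_zero],
        h.mono fun N hN => by rw [map_neg]; linarith⟩
  set r' : M.Elem →₀ ℝ := r.mapRange (fun t => max t 0) (max_self 0) with hr'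
  have hr'a : ∀ e, r' e = max (r e) 0 := fun e => by simp [hr']
  have hr'0 : 0 ≤ r' := fun e => by
    rw [hr'a]
    exact le_max_right _ _
  have hr'q : ∀ e, r' e ≠ 0 → q e ≠ 0 := by
    intro e he
    refine hrq e fun h => he ?_
    rw [hr'a, h, max_self]
  have hr'ne : r' ≠ 0 := by
    intro h
    obtain ⟨N, hN, hN0⟩ := (hrN.and (eventually_gt_atTop 0)).exists
    refine hN.not_ge ?_
    rw [Finsupp.linearCombination_apply]
    refine Finset.sum_nonpos fun e _ => mul_nonpos_of_nonpos_of_nonneg ?_ (pow_nonneg hN0.le _)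
    have := DFunLike.congr_fun h e
    rw [hr'a] at this
    simpa using this
  have ht := maxMultiple_pos hq0 hr'0 hr'ne hr'q
  have htle := maxMultiple_mul_le hq0 hr'0
  obtain ⟨e₀, he₀, he₀q⟩ := exists_eq_maxMultiple_mul (s := q) hr'ne
  set t := maxMultiple q r'
  have hval : ∀ e, (q - t • r : M.Elem →₀ ℝ) e = q e - t * r e := fun e => by simp
  have hsub : ∀ e, (q - t • r : M.Elem →₀ ℝ) e ≠ 0 → q e ≠ 0 := by
    intro e he h
    have h1 : r e = 0 := by_contra fun h1 => hrq e h1 h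
    rw [hval, h, h1] at he
    simp at he
  have hcard : (q - t • r).support.card < n := by
    rw [← hn]
    refine Finset.card_lt_card ⟨fun e he => ?_, fun h => ?_⟩
    · exact Finsupp.mem_support_iff.2 (hsub e (Finsupp.mem_support_iff.1 he))
    · have h1 := Finsupp.mem_support_iff.1 (h (Finsupp.mem_support_iff.2 (hr'q e₀ he₀)))
      rw [hval, he₀q, hr'a, max_eq_left, sub_self] at h1
      · exact h1 rfl
      · rw [hr'a] at he₀
        by_contra h2
        exact he₀ (max_eq_right (not_le.1 h2).le)
  have hrc : S.InFace c Elem.pt r := fun e he => hq.1 e (hrq e he)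
  obtain ⟨q', hq', hlt⟩ := ih _ hcard (q - t • r)
    ⟨hq.1.sub (hrc.smul t), hq.2.1, by rw [map_sub, map_smul, hr0, smul_zero, sub_zero, hq.2.2]⟩
    (fun e => by
      rw [hval]
      have h1 := htle e
      rw [hr'a] at h1
      exact sub_nonneg.2 ((mul_le_mul_of_nonneg_left (le_max_left _ _) ht.le).trans h1))
    (fun e he => hqE e (hsub e he)) rfl
  refine ⟨q', hq', Or.inr ?_⟩
  have hlt' : ∀ᶠ N : ℝ in atTop,
      weigh (fun e => N ^ idx e) (q - t • r) < weigh (fun e => N ^ idx e) q := by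
    filter_upwards [hrN] with N hN
    rw [map_sub, map_smul, smul_eq_mul]
    linarith [mul_pos ht hN]
  rcases hlt with rfl | hlt
  · exact hlt'
  · filter_upwards [hlt, hlt'] with N h1 h2 using h1.trans h2

/-- For generic weights, every point has a unique optimal representation as a conical combination of
the given elements. -/
theorem exists_optimal {M : MonoidalComplex S} {E : Finset M.Elem} {idx : M.Elem → ℕ}
    (hidx : Set.InjOn idx E) {c : S.faces} {p : X}
    (hex : ∃ q : M.Elem →₀ ℝ, S.IsComb c Elem.pt q p ∧ 0 ≤ q ∧ ∀ e, q e ≠ 0 → e ∈ E) :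
    ∃ q : M.Elem →₀ ℝ, (S.IsComb c Elem.pt q p ∧ 0 ≤ q ∧ ∀ e, q e ≠ 0 → e ∈ E) ∧
      ∀ q' : M.Elem →₀ ℝ, S.IsComb c Elem.pt q' p → 0 ≤ q' → (∀ e, q' e ≠ 0 → e ∈ E) →
        q' ≠ q → ∀ᶠ N : ℝ in atTop,
          weigh (fun e => N ^ idx e) q < weigh (fun e => N ^ idx e) q' := by
  set B := {q : M.Elem →₀ ℝ | S.IsComb c Elem.pt q p ∧ 0 ≤ q ∧ (∀ e, q e ≠ 0 → e ∈ E) ∧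
    ∀ r : M.Elem →₀ ℝ, (∀ e, r e ≠ 0 → q e ≠ 0) → S.comb c Elem.pt r = 0 → r = 0} with hB
  have hfin : B.Finite := by
    refine Set.Finite.of_finite_image (f := Finsupp.support)
      (E.powerset.finite_toSet.subset ?_) fun q hq q' hq' h => ?_
    · rintro _ ⟨q, hq, rfl⟩
      exact Finset.mem_coe.2 (Finset.mem_powerset.2 fun e he =>
        hq.2.2.1 e (Finsupp.mem_support_iff.1 he))
    · refine sub_eq_zero.1 (hq.2.2.2 _ (fun e he h0 => he ?_) ?_)
      · have h1 : q' e = 0 := by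
          rw [← Finsupp.notMem_support_iff] at h0 ⊢
          rwa [← h]
        simp [h0, h1]
      · rw [map_sub, hq.1.2.2, hq'.1.2.2, sub_self]
  have hne : B.Nonempty := by
    obtain ⟨q, h1, h2, h3⟩ := hex
    obtain ⟨q', hq', -⟩ := exists_independent_le hidx q h1 h2 h3
    exact ⟨q', hq'⟩
  obtain ⟨m, hm, hmin⟩ := Finset.exists_least_of_trichotomous
    (R := fun q q' : M.Elem →₀ ℝ => ∀ᶠ N : ℝ in atTop,
      weigh (fun e => N ^ idx e) q < weigh (fun e => N ^ idx e) q')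
    (fun a b c hab hbc => by filter_upwards [hab, hbc] with N h1 h2 using h1.trans h2)
    hfin.toFinset (by simpa using hne)
    (by
      intro a ha b hb
      have ha := hfin.mem_toFinset.1 ha
      have hb := hfin.mem_toFinset.1 hb
      by_cases hab : a = b
      · exact Or.inl hab
      · have hsupp : ∀ e ∈ (a - b).support, e ∈ E := by
          intro e he
          by_cases h0 : a e = 0
          · refine hb.2.2.1 e fun h1 => ?_
            have := Finsupp.mem_support_iff.1 he
            simp [h0, h1] at this
          · exact ha.2.2.1 e h0
        refine Or.inr ?_
        rcases eventually_weigh_pow_pos_or_neg (sub_ne_zero.2 hab) (hidx.mono hsupp) with h | h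
        · exact Or.inr (h.mono fun N hN => by rw [map_sub] at hN; linarith)
        · exact Or.inl (h.mono fun N hN => by rw [map_sub] at hN; linarith))
  have hm := hfin.mem_toFinset.1 hm
  refine ⟨m, ⟨hm.1, hm.2.1, hm.2.2.1⟩, fun q' h1 h2 h3 hne => ?_⟩
  obtain ⟨b, hb, hbq⟩ := exists_independent_le hidx q' h1 h2 h3
  rcases hmin b (hfin.mem_toFinset.2 hb) with rfl | h
  · exact hbq.resolve_left hne
  · rcases hbq with rfl | hbq
    · exact h
    · filter_upwards [h, hbq] with N h1 h2 using h1.trans h2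

theorem exists_triangulation (M : MonoidalComplex S) : Nonempty (Triangulation M) := by
  classical
  obtain ⟨E, hE⟩ := M.exists_finset_generating
  choose s hs hsE using hE
  obtain ⟨idx, hidx⟩ := Set.countable_iff_exists_injOn.1 E.finite_toSet.countable
  have key : ∀ p : X, ∃ q : M.Elem →₀ ℝ, ∀ c : S.faces, p ∈ (c : Set X) →
      (S.IsComb c Elem.pt q p ∧ 0 ≤ q ∧ ∀ e, q e ≠ 0 → e ∈ E) ∧
      ∀ q' : M.Elem →₀ ℝ, S.IsComb c Elem.pt q' p → 0 ≤ q' → (∀ e, q' e ≠ 0 → e ∈ E) →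
        q' ≠ q → ∀ᶠ N : ℝ in atTop,
          weigh (fun e => N ^ idx e) q < weigh (fun e => N ^ idx e) q' := by
    intro p
    by_cases h : ∃ c : S.faces, p ∈ (c : Set X)
    · obtain ⟨c, hc⟩ := h
      obtain ⟨q, ⟨h1, h2, h3⟩, h4⟩ :=
        exists_optimal hidx (exists_isComb_of_generating (hs c) (hsE c) hc)
      exact ⟨q, fun d hd => ⟨⟨h1.transport h2 hd, h2, h3⟩,
        fun q' h5 h6 h7 => h4 q' (h5.transport h6 hc) h6 h7⟩⟩
    · exact ⟨0, fun c hc => absurd ⟨c, hc⟩ h⟩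
  choose std hstd using key
  exact ⟨{
    verts := E
    std := std
    weights := atTop.map fun (N : ℝ) e => N ^ idx e
    neBot := inferInstance
    std_nonneg := fun c p hp => (hstd p c hp).1.2.1
    std_mem := fun c p hp => (hstd p c hp).1.2.2
    isComb_std := fun c p hp => (hstd p c hp).1.1
    weights_pos := by
      rw [eventually_map]
      filter_upwards [eventually_gt_atTop 0] with N hN e using pow_pos hN _
    std_lt := fun c p q h1 h2 h3 h4 => by
      rw [eventually_map]
      exact (hstd p c h1.2.1).2 q h1 h2 h3 h4 }⟩

end MonoidalComplex

/-! ### Monomials and the elements they represent -/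

/-- An exponent vector, considered as a vector of real coefficients. -/
noncomputable def toReal {ι : Type*} : (ι →₀ ℕ) →+ (ι →₀ ℝ) :=
  Finsupp.mapRange.addMonoidHom (Nat.castAddMonoidHom ℝ)

@[simp] theorem toReal_apply {ι : Type*} (m : ι →₀ ℕ) (i : ι) : toReal m i = m i := rfl

@[simp] theorem toReal_single {ι : Type*} (i : ι) (k : ℕ) :
    toReal (Finsupp.single i k) = Finsupp.single i (k : ℝ) := by
  simp [toReal]

theorem toReal_nonneg {ι : Type*} (m : ι →₀ ℕ) : 0 ≤ toReal m := fun i => Nat.cast_nonneg (m i)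

namespace MonoidalComplex

variable {M : MonoidalComplex S} {ι : Type*} {a : ι → M.Elem}

/-- The exponent vector `m` represents the element `y` of `|M|`: all members of the family `a` that
occur in the monomial with exponents `m` belong to a common monoid `M_c`, and `y` is their sum. -/
def Represents (a : ι → M.Elem) (m : ι →₀ ℕ) (y : M.Elem) : Prop :=
  ∃ c : S.faces, S.IsComb c (fun i => (a i).pt) (toReal m) y.pt

theorem Represents.isComb {m : ι →₀ ℕ} {y : M.Elem} (h : Represents a m y) {c : S.faces}
    (hc : y.1 ∈ (c : Set X)) : S.IsComb c (fun i => (a i).pt) (toReal m) y.pt := by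
  obtain ⟨d, hd⟩ := h
  exact hd.transport (toReal_nonneg m) hc

theorem Represents.unique {m : ι →₀ ℕ} {y z : M.Elem} (h : Represents a m y)
    (h' : Represents a m z) : y = z := by
  obtain ⟨c, hc⟩ := h
  obtain ⟨d, hd⟩ := h'
  exact Subtype.ext (hc.unique hd (toReal_nonneg m))

theorem comb_toReal_mem {c : S.faces} {m : ι →₀ ℕ}
    (h : S.InFace c (fun i => (a i).pt) (toReal m)) :
    S.comb c (fun i => (a i).pt) (toReal m) ∈ M.monoid c := by
  rw [comb_apply]
  refine sum_mem fun i hi => ?_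
  beta_reduce
  rw [toReal_apply, Nat.cast_smul_eq_nsmul]
  exact nsmul_mem (coord_mem_monoid (a i) (h i (Finsupp.mem_support_iff.1 hi))) _

theorem exists_represents {c : S.faces} {m : ι →₀ ℕ}
    (h : S.InFace c (fun i => (a i).pt) (toReal m)) :
    ∃ y : M.Elem, y.1 ∈ (c : Set X) ∧
      S.coord c y.1 = S.comb c (fun i => (a i).pt) (toReal m) ∧ Represents a m y := by
  obtain ⟨y, hy, hy', -⟩ := exists_elem (comb_toReal_mem h)
  exact ⟨y, hy, hy', c, h, hy, hy'.symm⟩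

theorem represents_single (i : ι) : Represents a (Finsupp.single i 1) (a i) := by
  obtain ⟨c, hc⟩ := (a i).exists_face
  exact ⟨c, by rw [toReal_single]; exact InFace.single (a := fun i => (a i).pt) hc _, hc, by simp⟩

theorem Represents.add {m m' : ι →₀ ℕ} {y y' z : M.Elem} (h : Represents a m y)
    (h' : Represents a m' y') (hz : M.IsSum y y' z) : Represents a (m + m') z := by
  obtain ⟨c, x, hx, x', hx', h1, h2, h3⟩ := hz
  have hxc := M.monoid_le hx
  have hxc' := M.monoid_le hx'
  have hy := h.isComb (h1 ▸ chart_mem hxc)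
  have hy' := h'.isComb (h2 ▸ chart_mem hxc')
  have hzc : z.pt ∈ (c : Set X) := by
    rw [Elem.pt, ← h3]
    exact chart_mem (add_mem hxc hxc')
  refine ⟨c, ?_, hzc, ?_⟩
  · rw [map_add]
    exact hy.1.add hy'.1
  · rw [map_add, map_add, hy.2.2, hy'.2.2, Elem.pt, Elem.pt, Elem.pt, ← h1, ← h2, ← h3,
      coord_chart hxc, coord_chart hxc', coord_chart (add_mem hxc hxc')]

theorem inFace_toReal_mono {c : S.faces} {m m' : ι →₀ ℕ}
    (h : S.InFace c (fun i => (a i).pt) (toReal m)) (hm : ∀ i, m' i ≠ 0 → m i ≠ 0) :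
    S.InFace c (fun i => (a i).pt) (toReal m') := by
  intro i hi
  rw [toReal_apply, Nat.cast_ne_zero] at hi
  exact h i (by rw [toReal_apply, Nat.cast_ne_zero]; exact hm i hi)

theorem Represents.exists_of_add {m m' : ι →₀ ℕ} {z : M.Elem} (h : Represents a (m + m') z) :
    ∃ y y', Represents a m y ∧ Represents a m' y' ∧ M.IsSum y y' z := by
  obtain ⟨c, h1, h2, h3⟩ := h
  obtain ⟨y, hy, hyc, hym⟩ := exists_represents
    (inFace_toReal_mono h1 (m' := m) fun i hi => by simp [hi])
  obtain ⟨y', hy', hyc', hym'⟩ := exists_represents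
    (inFace_toReal_mono h1 (m' := m') fun i hi => by simp [hi])
  refine ⟨y, y', hym, hym', c, _, coord_mem_monoid y hy, _, coord_mem_monoid y' hy',
    chart_coord hy, chart_coord hy', ?_⟩
  rw [hyc, hyc', ← map_add, ← map_add, h3, chart_coord h2]

theorem Generates.exists_represents {n : ℕ} {a : Fin n → M.Elem} (ha : M.Generates a) (y : M.Elem) :
    ∃ m, Represents a m y := by
  obtain ⟨c, hc⟩ := y.exists_face
  have key : ∀ x ∈ M.monoid c, ∃ m : Fin n →₀ ℕ, S.InFace c (fun i => (a i).pt) (toReal m) ∧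
      S.comb c (fun i => (a i).pt) (toReal m) = x := by
    intro x hx
    rw [← ha c] at hx
    induction hx using AddSubmonoid.closure_induction with
    | zero => exact ⟨0, by rw [map_zero]; exact fun _ h => absurd rfl h, by simp⟩
    | add x y _ _ hx hy =>
      obtain ⟨m, h1, h2⟩ := hx
      obtain ⟨m', h1', h2'⟩ := hy
      exact ⟨m + m', by rw [map_add]; exact h1.add h1', by rw [map_add, map_add, h2, h2']⟩
    | mem x hx =>
      obtain ⟨hx, i, hi⟩ := hx
      have hxc := M.monoid_le hx
      refine ⟨Finsupp.single i 1, ?_, ?_⟩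
      · rw [toReal_single]
        have hic : (a i).pt ∈ (c : Set X) := by
          rw [Elem.pt, hi]
          exact chart_mem hxc
        exact InFace.single (a := fun i => (a i).pt) hic _
      · rw [toReal_single, Nat.cast_one, comb_single, one_smul, Elem.pt, hi, coord_chart hxc]
  obtain ⟨m, h1, h2⟩ := key _ (coord_mem_monoid y hc)
  exact ⟨m, c, h1, hc, h2⟩

end MonoidalComplex

/-! ### The presentation ideal -/

section Presentation

open MonoidalComplex MvPolynomial

variable {M : MonoidalComplex S} {n : ℕ} {a : Fin n → M.Elem} {K : Type*} [Field K]

/-- In the toric face ring, a monomial becomes `t ^ y` if it represents `y`, and zero if it does not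
represent any element. -/
theorem aeval_monomial_one (m : Fin n →₀ ℕ) :
    (∀ y, Represents a m y → aeval (fun e => (ToricFaceRing.t (a e) : ToricFaceRing K M))
      (monomial m (1 : K)) = ToricFaceRing.t y) ∧
    ((¬ ∃ y, Represents a m y) → aeval (fun e => (ToricFaceRing.t (a e) : ToricFaceRing K M))
      (monomial m (1 : K)) = 0) := by
  classical
  have hadd : ∀ m m' : Fin n →₀ ℕ, monomial (m + m') (1 : K) = monomial m 1 * monomial m' 1 := by
    intro m m'
    rw [monomial_mul, one_mul]
  have hzero : ∀ y : M.Elem, Represents a 0 y →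
      (1 : ToricFaceRing K M) = ToricFaceRing.t y := by
    intro y hy
    obtain ⟨c, hc⟩ := y.exists_face
    have h : Nonempty S.faces := ⟨c⟩
    rw [ToricFaceRing.one_def, dif_pos h]
    congr 1
    refine Represents.unique (a := a) (m := 0) ⟨h.some, ?_, chart_mem (zero_mem _), ?_⟩ hy
    · rw [map_zero]
      exact fun _ h => absurd rfl h
    · rw [map_zero, map_zero]
      exact (coord_chart (zero_mem _)).symm
  have hone : (¬ ∃ y, Represents a 0 y) → (1 : ToricFaceRing K M) = 0 := by
    intro h
    rw [ToricFaceRing.one_def, dif_neg]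
    rintro ⟨c⟩
    obtain ⟨y, -, -, hy⟩ := MonoidalComplex.exists_represents (a := a) (c := c) (m := 0)
      (by rw [map_zero]; exact fun _ h => absurd rfl h)
    exact h ⟨y, hy⟩
  have hsum : ∀ m m' : Fin n →₀ ℕ,
      ((∀ y, Represents a m y → aeval (fun e => (ToricFaceRing.t (a e) : ToricFaceRing K M))
        (monomial m (1 : K)) = ToricFaceRing.t y) ∧
      ((¬ ∃ y, Represents a m y) → aeval (fun e => (ToricFaceRing.t (a e) : ToricFaceRing K M))
        (monomial m (1 : K)) = 0)) →
      ((∀ y, Represents a m' y → aeval (fun e => (ToricFaceRing.t (a e) : ToricFaceRing K M))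
        (monomial m' (1 : K)) = ToricFaceRing.t y) ∧
      ((¬ ∃ y, Represents a m' y) → aeval (fun e => (ToricFaceRing.t (a e) : ToricFaceRing K M))
        (monomial m' (1 : K)) = 0)) →
      ((∀ y, Represents a (m + m') y →
        aeval (fun e => (ToricFaceRing.t (a e) : ToricFaceRing K M))
        (monomial (m + m') (1 : K)) = ToricFaceRing.t y) ∧
      ((¬ ∃ y, Represents a (m + m') y) →
        aeval (fun e => (ToricFaceRing.t (a e) : ToricFaceRing K M))
        (monomial (m + m') (1 : K)) = 0)) := by
    rintro m m' ⟨h1, h2⟩ ⟨h1', h2'⟩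
    rw [hadd, map_mul]
    refine ⟨fun z hz => ?_, fun hz => ?_⟩
    · obtain ⟨y, y', hy, hy', hyz⟩ := hz.exists_of_add
      rw [h1 y hy, h1' y' hy', ToricFaceRing.t_mul_t_of_isSum hyz]
    · by_cases hy : ∃ y, Represents a m y
      · obtain ⟨y, hy⟩ := hy
        by_cases hy' : ∃ y', Represents a m' y'
        · obtain ⟨y', hy'⟩ := hy'
          rw [h1 y hy, h1' y' hy', ToricFaceRing.t_mul_t_of_not]
          rintro ⟨z, hyz⟩
          exact hz ⟨z, hy.add hy' hyz⟩
        · rw [h2' hy', mul_zero]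
      · rw [h2 hy, zero_mul]
  have h0 : (∀ y, Represents a 0 y → aeval (fun e => (ToricFaceRing.t (a e) : ToricFaceRing K M))
      (monomial 0 (1 : K)) = ToricFaceRing.t y) ∧
      ((¬ ∃ y, Represents a 0 y) → aeval (fun e => (ToricFaceRing.t (a e) : ToricFaceRing K M))
      (monomial 0 (1 : K)) = 0) := by
    have h1 : (monomial (0 : Fin n →₀ ℕ) (1 : K)) = 1 := rfl
    rw [h1, map_one]
    exact ⟨hzero, hone⟩
  induction m using Finsupp.induction_linear with
  | zero => exact h0
  | add m m' hm hm' => exact hsum m m' hm hm'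
  | single i k =>
    induction k with
    | zero => simpa using h0
    | succ k ih =>
      rw [Finsupp.single_add]
      refine hsum _ _ ih ⟨fun y hy => ?_, fun h => absurd ⟨_, represents_single i⟩ h⟩
      rw [hy.unique (represents_single i)]
      exact aeval_X _ i

theorem sub_mem_presentationIdeal {m m' : Fin n →₀ ℕ} {y : M.Elem} (h : Represents a m y)
    (h' : Represents a m' y) : monomial m (1 : K) - monomial m' 1 ∈ M.presentationIdeal K a := by
  rw [presentationIdeal, RingHom.mem_ker, map_sub, sub_eq_zero]
  exact ((aeval_monomial_one m).1 y h).trans ((aeval_monomial_one m').1 y h').symm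

theorem monomial_mem_presentationIdeal {m : Fin n →₀ ℕ} (h : ¬ ∃ y, Represents a m y) :
    monomial m (1 : K) ∈ M.presentationIdeal K a := by
  rw [presentationIdeal, RingHom.mem_ker]
  exact (aeval_monomial_one m).2 h

/-- The presentation ideal is graded by `|M|`: in its elements, a monomial that represents an element
of `|M|` has to cancel with another one that represents the same element. -/
theorem exists_represents_of_mem_presentationIdeal {f : MvPolynomial (Fin n) K}
    (hf : f ∈ M.presentationIdeal K a) {m : Fin n →₀ ℕ} (hm : m ∈ f.support) {y : M.Elem}
    (hy : Represents a m y) : ∃ m' ∈ f.support, m' ≠ m ∧ Represents a m' y := by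
  classical
  by_contra! hcon
  rw [presentationIdeal, RingHom.mem_ker] at hf
  have h1 : aeval (fun e => (ToricFaceRing.t (a e) : ToricFaceRing K M)) f =
      ∑ u ∈ f.support, coeff u f • aeval (fun e => (ToricFaceRing.t (a e) : ToricFaceRing K M))
        (monomial u (1 : K)) := by
    conv_lhs => rw [f.as_sum, map_sum]
    refine Finset.sum_congr rfl fun u _ => ?_
    rw [← map_smul, smul_monomial, smul_eq_mul, mul_one]
  have h2 : ToricFaceRing.basis.repr
      (aeval (fun e => (ToricFaceRing.t (a e) : ToricFaceRing K M)) f) y = coeff m f := by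
    rw [h1, map_sum, Finsupp.finsetSum_apply, Finset.sum_eq_single m]
    · rw [(aeval_monomial_one m).1 y hy, map_smul, ToricFaceRing.t, Module.Basis.repr_self]
      simp
    · intro u hu hum
      rw [map_smul, Finsupp.smul_apply]
      by_cases h : ∃ z, Represents a u z
      · obtain ⟨z, hz⟩ := h
        have hzy : z ≠ y := by
          rintro rfl
          exact hcon u hu hum hz
        rw [(aeval_monomial_one u).1 z hz, ToricFaceRing.t, Module.Basis.repr_self,
          Finsupp.single_eq_of_ne' hzy, smul_zero]
      · rw [(aeval_monomial_one u).2 h, map_zero, Finsupp.zero_apply, smul_zero]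
    · exact fun h => absurd hm h
  have h3 : aeval (fun e => (ToricFaceRing.t (a e) : ToricFaceRing K M)) f = 0 := hf
  rw [h3, map_zero, Finsupp.zero_apply] at h2
  exact mem_support_iff.1 hm h2.symm

end Presentation

/-! ### Initial ideals -/

section InitialIdeal

open MvPolynomial

variable {K : Type*} [Field K] {n : ℕ} {w : Fin n → ℕ}

theorem coeff_initialComponent {f : MvPolynomial (Fin n) K} {d : ℕ}
    (hle : ∀ m ∈ f.support, Finsupp.weight w m ≤ d)
    (hex : ∃ m ∈ f.support, Finsupp.weight w m = d) (m : Fin n →₀ ℕ) :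
    coeff m (initialComponent w f) = if Finsupp.weight w m = d then coeff m f else 0 := by
  classical
  have hd : weightedTotalDegree w f = d := by
    obtain ⟨u, hu, hud⟩ := hex
    exact le_antisymm (Finset.sup_le hle) (hud ▸ le_weightedTotalDegree w hu)
  rw [initialComponent, hd, coeff_weightedHomogeneousComponent]

theorem initialComponent_monomial (m : Fin n →₀ ℕ) :
    initialComponent w (monomial m (1 : K)) = monomial m 1 := by
  classical
  ext u
  rw [coeff_initialComponent (d := Finsupp.weight w m)]
  · rw [coeff_monomial]
    split_ifs with h1 _ h2
    · rfl
    · rfl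
    · exact absurd (by rw [h2]) h1
    · rfl
  · intro u hu
    rw [Finset.mem_singleton.1 (support_monomial_subset hu)]
  · exact ⟨m, by simp [mem_support_iff], rfl⟩

theorem initialComponent_sub {m m' : Fin n →₀ ℕ}
    (h : Finsupp.weight w m' < Finsupp.weight w m) :
    initialComponent w (monomial m (1 : K) - monomial m' 1) = monomial m 1 := by
  classical
  have hne : m' ≠ m := by
    rintro rfl
    exact lt_irrefl _ h
  ext u
  rw [coeff_initialComponent (d := Finsupp.weight w m)]
  · rw [coeff_sub, coeff_monomial, coeff_monomial]
    split_ifs with h1 h2 h3 h3 h2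
    · exact absurd (h3.trans h2.symm) hne
    · rw [sub_zero]
    · subst h3
      exact absurd h1 h.ne
    · rw [sub_zero]
    · subst h2
      exact absurd rfl h1
    · rfl
  · intro u hu
    rcases Finset.mem_union.1 (support_sub _ _ _ hu) with hu | hu
    · rw [Finset.mem_singleton.1 (support_monomial_subset hu)]
    · rw [Finset.mem_singleton.1 (support_monomial_subset hu)]
      exact h.le
  · exact ⟨m, by simp [mem_support_iff, coeff_monomial, hne], rfl⟩

theorem initialComponent_sub_of_eq {m m' : Fin n →₀ ℕ} (hne : m' ≠ m)
    (h : Finsupp.weight w m' = Finsupp.weight w m) :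
    initialComponent w (monomial m (1 : K) - monomial m' 1) = monomial m 1 - monomial m' 1 := by
  classical
  ext u
  rw [coeff_initialComponent (d := Finsupp.weight w m)]
  · split_ifs with h1
    · rfl
    · rw [coeff_sub, coeff_monomial, coeff_monomial, if_neg, if_neg, sub_zero]
      · rintro rfl
        exact h1 h
      · rintro rfl
        exact h1 rfl
  · intro u hu
    rcases Finset.mem_union.1 (support_sub _ _ _ hu) with hu | hu
    · rw [Finset.mem_singleton.1 (support_monomial_subset hu)]
    · rw [Finset.mem_singleton.1 (support_monomial_subset hu), h]
  · exact ⟨m, by simp [mem_support_iff, coeff_monomial, hne], rfl⟩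

theorem initialComponent_mem {I : Ideal (MvPolynomial (Fin n) K)} {f : MvPolynomial (Fin n) K}
    (hf : f ∈ I) : initialComponent w f ∈ initialIdeal w I :=
  Ideal.subset_span ⟨f, hf, rfl⟩

/-- The homogeneous components of the elements of the initial ideal are components of highest degree
of elements of the ideal. -/
theorem exists_of_mem_initialIdeal {I : Ideal (MvPolynomial (Fin n) K)}
    {g : MvPolynomial (Fin n) K} (hg : g ∈ initialIdeal w I) (d : ℕ) :
    ∃ f ∈ I, (∀ m ∈ f.support, Finsupp.weight w m ≤ d) ∧
      ∀ m, Finsupp.weight w m = d → coeff m f = coeff m g := by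
  classical
  rw [initialIdeal, Ideal.span] at hg
  have hadd : ∀ g g' : MvPolynomial (Fin n) K,
      (∀ d, ∃ f ∈ I, (∀ m ∈ f.support, Finsupp.weight w m ≤ d) ∧
        ∀ m, Finsupp.weight w m = d → coeff m f = coeff m g) →
      (∀ d, ∃ f ∈ I, (∀ m ∈ f.support, Finsupp.weight w m ≤ d) ∧
        ∀ m, Finsupp.weight w m = d → coeff m f = coeff m g') →
      ∀ d, ∃ f ∈ I, (∀ m ∈ f.support, Finsupp.weight w m ≤ d) ∧
        ∀ m, Finsupp.weight w m = d → coeff m f = coeff m (g + g') := by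
    intro g g' hg hg' d
    obtain ⟨f, h1, h2, h3⟩ := hg d
    obtain ⟨f', h1', h2', h3'⟩ := hg' d
    refine ⟨f + f', add_mem h1 h1', fun m hm => ?_, fun m hm => ?_⟩
    · rcases Finset.mem_union.1 (support_add hm) with hm | hm
      · exact h2 m hm
      · exact h2' m hm
    · rw [coeff_add, coeff_add, h3 m hm, h3' m hm]
  induction hg using Submodule.span_induction generalizing d with
  | mem x hx =>
    obtain ⟨f, hf, rfl⟩ := hx
    by_cases h : weightedTotalDegree w f = d
    · refine ⟨f, hf, fun m hm => h ▸ le_weightedTotalDegree w hm, fun m hm => ?_⟩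
      rw [initialComponent, coeff_weightedHomogeneousComponent, if_pos (hm.trans h.symm)]
    · refine ⟨0, zero_mem _, by simp, fun m hm => ?_⟩
      rw [initialComponent, coeff_weightedHomogeneousComponent, if_neg fun h' => h (h'.symm.trans hm),
        coeff_zero]
  | zero => exact ⟨0, zero_mem _, by simp, fun _ _ => rfl⟩
  | add x y _ _ hx hy => exact hadd x y hx hy d
  | smul p x _ hx =>
    rw [smul_eq_mul]
    induction p using MvPolynomial.induction_on generalizing x d with
    | C k =>
      obtain ⟨f, h1, h2, h3⟩ := hx d
      refine ⟨C k * f, Ideal.mul_mem_left _ _ h1, fun m hm => h2 m ?_, fun m hm => ?_⟩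
      · rw [mem_support_iff, coeff_C_mul] at hm
        exact mem_support_iff.2 (right_ne_zero_of_mul hm)
      · rw [coeff_C_mul, coeff_C_mul, h3 m hm]
    | add p q hp hq =>
      rw [add_mul]
      exact hadd _ _ (hp x ‹_› hx) (hq x ‹_› hx) d
    | mul_X p i hp =>
      rw [mul_assoc]
      refine hp (d := d) (X i * x) (Ideal.mul_mem_left _ _ ‹_›) fun d => ?_
      by_cases hd : w i ≤ d
      · obtain ⟨f, h1, h2, h3⟩ := hx (d - w i)
        have hwt : ∀ m : Fin n →₀ ℕ, i ∈ m.support →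
            Finsupp.weight w m = Finsupp.weight w (m - Finsupp.single i 1) + w i := by
          intro m hm
          have h4 : m - Finsupp.single i 1 + Finsupp.single i 1 = m :=
            tsub_add_cancel_of_le (Finsupp.single_le_iff.2
              (Nat.one_le_iff_ne_zero.2 (Finsupp.mem_support_iff.1 hm)))
          conv_lhs => rw [← h4, map_add, Finsupp.weight_single, one_smul]
        refine ⟨X i * f, Ideal.mul_mem_left _ _ h1, fun m hm => ?_, fun m hm => ?_⟩
        · rw [mem_support_iff, coeff_X_mul'] at hm
          split_ifs at hm with him
          · have := h2 _ (mem_support_iff.2 hm)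
            rw [hwt m him]
            omega
          · exact absurd rfl hm
        · rw [coeff_X_mul', coeff_X_mul']
          split_ifs with him
          · refine h3 _ ?_
            rw [hwt m him] at hm
            omega
          · rfl
      · refine ⟨0, zero_mem _, by simp, fun m hm => ?_⟩
        rw [coeff_zero, coeff_X_mul', if_neg]
        intro him
        have h4 : Finsupp.single i 1 ≤ m := Finsupp.single_le_iff.2
          (Nat.one_le_iff_ne_zero.2 (Finsupp.mem_support_iff.1 him))
        have h5 : Finsupp.weight w m =
            Finsupp.weight w (m - Finsupp.single i 1) + w i := by
          conv_lhs => rw [← tsub_add_cancel_of_le h4, map_add, Finsupp.weight_single, one_smul]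
        omega

theorem IsMonomialIdeal.monomial_mem {J : Ideal (MvPolynomial (Fin n) K)} (hJ : IsMonomialIdeal J)
    {f : MvPolynomial (Fin n) K} (hf : f ∈ J) {m : Fin n →₀ ℕ} (hm : m ∈ f.support) :
    monomial m (1 : K) ∈ J := by
  classical
  obtain ⟨A, rfl⟩ := hJ
  rw [mem_ideal_span_monomial_image] at hf ⊢
  intro u hu
  rw [Finset.mem_singleton.1 (support_monomial_subset hu)]
  exact hf m hm

/-- Ideals generated by variables are prime; in particular they are radical. -/
theorem mem_span_X_of_pow_mem {s : Set (Fin n)} {f : MvPolynomial (Fin n) K} {k : ℕ}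
    (hf : f ^ k ∈ Ideal.span (MvPolynomial.X '' s : Set (MvPolynomial (Fin n) K))) :
    f ∈ Ideal.span (MvPolynomial.X '' s : Set (MvPolynomial (Fin n) K)) := by
  classical
  set J := Ideal.span (MvPolynomial.X '' s : Set (MvPolynomial (Fin n) K))
  set φ : MvPolynomial (Fin n) K →ₐ[K] MvPolynomial (Fin n) K :=
    aeval fun i => if i ∈ s then 0 else X i with hφ
  have h1 : ∀ g ∈ J, φ g = 0 := by
    intro g hg
    have : J ≤ RingHom.ker φ := by
      rw [Ideal.span_le]
      rintro _ ⟨i, hi, rfl⟩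
      simp [hφ, RingHom.mem_ker, hi]
    exact this hg
  have h2 : (Ideal.Quotient.mkₐ K J).comp φ = Ideal.Quotient.mkₐ K J := by
    ext i
    by_cases hi : i ∈ s
    · have : Ideal.Quotient.mk J (X i) = 0 :=
        Ideal.Quotient.eq_zero_iff_mem.2 (Ideal.subset_span ⟨i, hi, rfl⟩)
      simp [hφ, hi, this]
    · simp [hφ, hi]
  have h3 := h1 _ hf
  rw [map_pow] at h3
  have h4 := AlgHom.congr_fun h2 f
  rw [AlgHom.comp_apply, eq_zero_of_pow_eq_zero h3, map_zero] at h4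
  exact Ideal.Quotient.eq_zero_iff_mem.1 h4.symm

end InitialIdeal

/-! ### Radical monomial initial ideals imply normality -/

namespace MonoidalComplex

open MvPolynomial

section Standard

variable {M : MonoidalComplex S} {n : ℕ} {a : Fin n → M.Elem} {K : Type*} [Field K]
  {w : Fin n → ℕ}

/-- A representation of least weight is standard: an element of the presentation ideal with this
leading monomial would contain another representation of smaller weight. -/
theorem exists_represents_notMem_initialIdeal (ha : M.Generates a) (y : M.Elem) :
    ∃ m, monomial m (1 : K) ∉ initialIdeal w (M.presentationIdeal K a) ∧ Represents a m y := by
  classical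
  obtain ⟨m, hm, hmin⟩ := exists_minimalFor_of_wellFoundedLT (fun m => Represents a m y)
    (Finsupp.weight w) (ha.exists_represents y)
  refine ⟨m, fun hmem => ?_, hm⟩
  obtain ⟨f, hf, hle, heq⟩ := exists_of_mem_initialIdeal hmem (Finsupp.weight w m)
  have hmf : m ∈ f.support := by
    rw [mem_support_iff, heq m rfl, coeff_monomial, if_pos rfl]
    exact one_ne_zero
  obtain ⟨m', hm', hne, hy'⟩ := exists_represents_of_mem_presentationIdeal hf hmf hm
  have h1 : Finsupp.weight w m' = Finsupp.weight w m :=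
    le_antisymm (hle m' hm') (le_of_not_gt fun h => (hmin hy' h.le).not_gt h)
  rw [mem_support_iff, heq m' h1, coeff_monomial, if_neg hne.symm] at hm'
  exact hm' rfl

/-- Two standard monomials cannot represent the same element, since some term of their difference
belongs to the initial ideal. -/
theorem eq_of_notMem_initialIdeal
    (hmon : IsMonomialIdeal (initialIdeal w (M.presentationIdeal K a))) {m m' : Fin n →₀ ℕ}
    {y : M.Elem} (hm : Represents a m y) (hm' : Represents a m' y)
    (h : monomial m (1 : K) ∉ initialIdeal w (M.presentationIdeal K a))
    (h' : monomial m' (1 : K) ∉ initialIdeal w (M.presentationIdeal K a)) : m = m' := by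
  classical
  by_contra hne
  rcases lt_trichotomy (Finsupp.weight w m) (Finsupp.weight w m') with hlt | heq | hlt
  · have := initialComponent_mem (w := w) (sub_mem_presentationIdeal (K := K) hm' hm)
    rw [initialComponent_sub hlt] at this
    exact h' this
  · have := initialComponent_mem (w := w) (sub_mem_presentationIdeal (K := K) hm' hm)
    rw [initialComponent_sub_of_eq hne heq] at this
    refine h' (hmon.monomial_mem this ?_)
    simp [mem_support_iff, coeff_monomial, hne]
  · have := initialComponent_mem (w := w) (sub_mem_presentationIdeal (K := K) hm hm')
    rw [initialComponent_sub hlt] at this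
    exact h this

/-- Whether a monomial belongs to a radical ideal depends only on its support. -/
theorem notMem_of_support {J : Ideal (MvPolynomial (Fin n) K)} (hJ : J.IsRadical)
    {m m' : Fin n →₀ ℕ} (h : monomial m (1 : K) ∉ J) (hm : ∀ i, m' i ≠ 0 → m i ≠ 0) :
    monomial m' (1 : K) ∉ J := by
  intro h'
  refine h (hJ ⟨∑ i, m' i, ?_⟩)
  have hle : m' ≤ (∑ i, m' i) • m := by
    intro i
    by_cases hi : m' i = 0
    · rw [hi]
      exact Nat.zero_le _
    · calc m' i ≤ ∑ i, m' i := Finset.single_le_sum (fun _ _ => Nat.zero_le _) (Finset.mem_univ i)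
        _ ≤ (∑ i, m' i) * m i := Nat.le_mul_of_pos_right _ (Nat.pos_of_ne_zero (hm i hi))
  rw [monomial_pow, one_pow, ← tsub_add_cancel_of_le hle, ← one_mul (1 : K), ← monomial_mul]
  exact J.mul_mem_left _ h'

end Standard

section Normality

variable {M : MonoidalComplex S} {n : ℕ} {a : Fin n → M.Elem}

/-- A multiple of an element of `gp(M_c) ∩ ℝ₊ M_c` belongs to `M_c`. This is a pigeonhole argument:
if `x = ∑ q e • e` then the integer vectors `∑ (fractional part of j * q e) • e` are bounded, so two
of them agree. -/
theorem exists_nsmul_mem (M : MonoidalComplex S) (c : S.faces) {x : Fin (S.dim c) → ℝ}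
    (hx : x ∈ AddSubgroup.closure (M.monoid c : Set (Fin (S.dim c) → ℝ))) (hxc : x ∈ S.cone c) :
    ∃ k : ℕ, 0 < k ∧ k • x ∈ M.monoid c := by
  obtain ⟨E, hE⟩ := M.exists_finset_generating
  obtain ⟨s, hs, hsE⟩ := hE c
  obtain ⟨q, hq, hq0, -⟩ := exists_isComb_of_generating hs hsE (chart_mem hxc)
  have hqx := hq.2.2
  rw [coord_chart hxc, comb_apply, Finsupp.sum] at hqx
  set v : M.Elem → Fin (S.dim c) → ℝ := fun e => S.coord c e.pt with hv
  have hvM : ∀ e ∈ q.support, v e ∈ M.monoid c := fun e he =>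
    coord_mem_monoid e (hq.1 e (Finsupp.mem_support_iff.1 he))
  have hint : ∀ z ∈ AddSubgroup.closure (M.monoid c : Set (Fin (S.dim c) → ℝ)),
      ∀ i, ∃ k : ℤ, z i = k := by
    intro z hz
    induction hz using AddSubgroup.closure_induction with
    | mem z hz => exact M.integral c z hz
    | zero => exact fun i => ⟨0, by simp⟩
    | add z z' _ _ h h' =>
      intro i
      obtain ⟨k, hk⟩ := h i
      obtain ⟨k', hk'⟩ := h' i
      exact ⟨k + k', by simp [hk, hk']⟩
    | neg z _ h =>
      intro i
      obtain ⟨k, hk⟩ := h i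
      exact ⟨-k, by simp [hk]⟩
  set f : ℕ → Fin (S.dim c) → ℝ := fun j => j • x - ∑ e ∈ q.support, ⌊j * q e⌋₊ • v e with hf
  have hf' : ∀ j, f j = ∑ e ∈ q.support, Int.fract (j * q e) • v e := by
    intro j
    rw [hf]
    beta_reduce
    rw [← hqx, Finset.smul_sum, ← Finset.sum_sub_distrib]
    refine Finset.sum_congr rfl fun e _ => ?_
    have h1 : (0 : ℝ) ≤ j * q e := mul_nonneg (Nat.cast_nonneg _) (hq0 e)
    rw [← Nat.cast_smul_eq_nsmul ℝ, ← Nat.cast_smul_eq_nsmul ℝ, smul_smul, ← sub_smul,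
      Int.fract, natCast_floor_eq_intCast_floor h1]
  have hfin := finite_bounded_integral fun i => ∑ e ∈ q.support, |v e i|
  have hmaps : Set.MapsTo f Set.univ
      {x | (∀ i, ∃ z : ℤ, x i = z) ∧ ∀ i, |x i| ≤ ∑ e ∈ q.support, |v e i|} := by
    intro j _
    refine ⟨hint _ (sub_mem (nsmul_mem hx _) (sum_mem fun e he => nsmul_mem
      (AddSubgroup.subset_closure (hvM e he)) _)), fun i => ?_⟩
    rw [hf', Finset.sum_apply]
    refine (Finset.abs_sum_le_sum_abs _ _).trans (Finset.sum_le_sum fun e _ => ?_)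
    rw [Pi.smul_apply, smul_eq_mul, abs_mul, abs_of_nonneg (Int.fract_nonneg _)]
    exact mul_le_of_le_one_left (abs_nonneg _) (Int.fract_lt_one _).le
  obtain ⟨j, -, j', -, hlt, hjj⟩ := Set.infinite_univ.exists_lt_map_eq_of_mapsTo hmaps hfin
  refine ⟨j' - j, by omega, ?_⟩
  have h1 : (j' - j) • x = ∑ e ∈ q.support, (⌊j' * q e⌋₊ - ⌊j * q e⌋₊) • v e := by
    have h2 : ∀ e ∈ q.support, (⌊j' * q e⌋₊ - ⌊j * q e⌋₊) • v e =
        ⌊j' * q e⌋₊ • v e - ⌊j * q e⌋₊ • v e := by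
      intro e _
      have h3 : ⌊j * q e⌋₊ ≤ ⌊j' * q e⌋₊ :=
        Nat.floor_mono (mul_le_mul_of_nonneg_right (by exact_mod_cast hlt.le) (hq0 e))
      rw [sub_nsmul _ h3, sub_eq_add_neg]
    rw [Finset.sum_congr rfl h2, Finset.sum_sub_distrib, sub_nsmul _ hlt.le, ← sub_eq_add_neg]
    simp only [hf] at hjj
    rw [sub_eq_sub_iff_add_eq_add] at hjj
    rw [sub_eq_sub_iff_add_eq_add, ← hjj, add_comm]
  rw [h1]
  exact sum_mem fun e he => nsmul_mem (hvM e he) _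

/-- A monoidal complex is normal if its elements are uniquely represented by the monomials in a set
that is determined by supports. The maximal supports define unimodular cones, and the cones of all
supports cover the complex. -/
theorem isNormalMonoid_of_standard {Std : (Fin n →₀ ℕ) → Prop}
    (hex : ∀ y, ∃ m, Std m ∧ Represents a m y)
    (huniq : ∀ m m' y, Std m → Std m' → Represents a m y → Represents a m' y → m = m')
    (hsupp : ∀ m m' : Fin n →₀ ℕ, Std m → (∀ i, m' i ≠ 0 → m i ≠ 0) → Std m')
    (c : S.faces) : IsNormalMonoid (M.monoid c) := by
  classical
  rw [IsNormalMonoid, M.hull_monoid]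
  refine Set.Subset.antisymm (fun x hx => ⟨AddSubgroup.subset_closure hx, M.monoid_le hx⟩) ?_
  rintro x ⟨hx, hxc⟩
  set ev : (Fin n →₀ ℕ) → Fin (S.dim c) → ℝ :=
    fun m => S.comb c (fun i => (a i).pt) (toReal m) with hev
  have ev_add : ∀ m m', ev (m + m') = ev m + ev m' := fun m m' => by simp [hev]
  have ev_nsmul : ∀ (k : ℕ) m, ev (k • m) = k • ev m := fun k m => by simp [hev]
  set InC : (Fin n →₀ ℕ) → Prop := fun m => S.InFace c (fun i => (a i).pt) (toReal m) with hInC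
  have inC_mono : ∀ m m' : Fin n →₀ ℕ, InC m → (∀ i, m' i ≠ 0 → m i ≠ 0) → InC m' :=
    fun m m' h hm => inFace_toReal_mono h hm
  -- standard monomials over the elements of `M_c`
  have hex' : ∀ v ∈ M.monoid c, ∃ m, Std m ∧ InC m ∧ ev m = v := by
    intro v hv
    obtain ⟨y, hy, hyv, -⟩ := exists_elem hv
    obtain ⟨m, hm, hmy⟩ := hex y
    have := hmy.isComb hy
    exact ⟨m, hm, this.1, this.2.2.trans hyv⟩
  have huniq' : ∀ m m', Std m → Std m' → InC m → InC m' → ev m = ev m' → m = m' := by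
    intro m m' h h' hc hc' he
    obtain ⟨y, hy, hye, hmy⟩ := exists_represents hc
    refine huniq m m' y h h' hmy ⟨c, hc', hy, ?_⟩
    rw [Elem.pt, hye]
    exact he.symm
  obtain ⟨k, hk, hkx⟩ := M.exists_nsmul_mem c hx hxc
  obtain ⟨m₀, hm₀, hm₀c, hm₀x⟩ := hex' _ hkx
  -- a maximal support that contains the support of `m₀`
  obtain ⟨m₁, ⟨hm₁, hm₁c, hm₀₁⟩, hmax⟩ : ∃ m₁, (Std m₁ ∧ InC m₁ ∧ m₀.support ⊆ m₁.support) ∧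
      ∀ m, Std m → InC m → m₁.support ⊆ m.support → m.support ⊆ m₁.support := by
    obtain ⟨F, hF, hFmax⟩ := Set.Finite.exists_maximal
      (s := {F : Finset (Fin n) | ∃ m, Std m ∧ InC m ∧ m₀.support ⊆ m.support ∧ m.support = F})
      (Set.toFinite _) ⟨_, m₀, hm₀, hm₀c, subset_rfl, rfl⟩
    obtain ⟨m₁, h1, h2, h3, rfl⟩ := hF
    exact ⟨m₁, ⟨h1, h2, h3⟩, fun m h1' h2' h3' =>
      hFmax ⟨m, h1', h2', h3.trans h3', rfl⟩ h3'⟩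
  have hstd₁ : ∀ m : Fin n →₀ ℕ, (∀ i, m i ≠ 0 → m₁ i ≠ 0) → Std m ∧ InC m := fun m hm =>
    ⟨hsupp m₁ m hm₁ hm, inC_mono m₁ m hm₁c hm⟩
  have hmonoid : ∀ v ∈ M.monoid c, ∃ (p : Fin n →₀ ℕ) (j : ℕ), (∀ i, p i ≠ 0 → m₁ i ≠ 0) ∧
      v = ev p - j • ev m₁ := by
    intro v hv
    have h1 : ∀ j : ℕ, j • ev m₁ + v ∈ M.monoid c := fun j =>
      add_mem (nsmul_mem (comb_toReal_mem hm₁c) j) hv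
    choose f hf1 hf2 hf3 using fun j => hex' _ (h1 j)
    obtain ⟨i, j, hij, hle⟩ := wellQuasiOrdered_le f
    -- the difference of two comparable terms represents a multiple of `ev m₁`
    have h2 : f j - f i = (j - i) • m₁ := by
      have h3 : ∀ e, (f j - f i) e ≠ 0 → f j e ≠ 0 := by
        intro e he h0
        simp [h0] at he
      have h4 := hstd₁ ((j - i) • m₁) fun e he h0 => by simp [h0] at he
      refine huniq' _ _ (hsupp _ _ (hf1 j) h3) h4.1 (inC_mono _ _ (hf2 j) h3) h4.2 ?_
      have h5 : ev (f j - f i) + ev (f i) = ev (f j) := by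
        rw [← ev_add, tsub_add_cancel_of_le hle]
      rw [hf3, hf3] at h5
      rw [ev_nsmul, sub_nsmul _ hij.le, ← sub_eq_add_neg, eq_sub_of_add_eq h5]
      abel
    have h3 : m₁.support ⊆ (f j).support := by
      intro e he
      have h4 := DFunLike.congr_fun h2 e
      rw [Finsupp.mem_support_iff] at he ⊢
      intro h0
      rw [Finsupp.tsub_apply, h0, Nat.zero_sub, Finsupp.smul_apply, smul_eq_mul, eq_comm,
        mul_eq_zero] at h4
      rcases h4 with h4 | h4
      · omega
      · exact he h4
    refine ⟨f j, j, fun e he => ?_, ?_⟩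
    · exact Finsupp.mem_support_iff.1
        (hmax _ (hf1 j) (hf2 j) h3 (Finsupp.mem_support_iff.2 he))
    · rw [hf3, add_sub_cancel_left]
  have hgroup : ∀ v ∈ AddSubgroup.closure (M.monoid c : Set (Fin (S.dim c) → ℝ)),
      ∃ (p : Fin n →₀ ℕ) (j : ℕ), (∀ i, p i ≠ 0 → m₁ i ≠ 0) ∧ v = ev p - j • ev m₁ := by
    intro v hv
    induction hv using AddSubgroup.closure_induction with
    | mem v hv => exact hmonoid v hv
    | zero => exact hmonoid 0 (zero_mem _)
    | add v v' _ _ h h' =>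
      obtain ⟨p, j, hp, rfl⟩ := h
      obtain ⟨p', j', hp', rfl⟩ := h'
      refine ⟨p + p', j + j', fun i hi h0 => ?_, ?_⟩
      · have h1 : p i = 0 := by_contra fun h => hp i h h0
        have h2 : p' i = 0 := by_contra fun h => hp' i h h0
        simp [h1, h2] at hi
      · rw [ev_add, add_nsmul]
        abel
    | neg v _ h =>
      obtain ⟨p, j, hp, rfl⟩ := h
      have hle : p ≤ (∑ i, p i) • m₁ := by
        intro i
        by_cases hi : p i = 0
        · rw [hi]
          exact Nat.zero_le _
        · calc p i ≤ ∑ i, p i := Finset.single_le_sum (fun _ _ => Nat.zero_le _) (Finset.mem_univ i)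
            _ ≤ (∑ i, p i) * m₁ i :=
              Nat.le_mul_of_pos_right _ (Nat.pos_of_ne_zero (hp i hi))
      refine ⟨(∑ i, p i) • m₁ - p + j • m₁, ∑ i, p i, fun i hi h0 => ?_, ?_⟩
      · simp [h0] at hi
      · have h1 : ev ((∑ i, p i) • m₁ - p) + ev p = (∑ i, p i) • ev m₁ := by
          rw [← ev_add, tsub_add_cancel_of_le hle, ev_nsmul]
        rw [ev_add, ev_nsmul, eq_sub_of_add_eq h1]
        abel
  obtain ⟨p, j, hp, hpx⟩ := hgroup x hx
  -- compare two representations of `k • x + (k * j) • ev m₁` by standard monomials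
  have hkp : k • p = m₀ + (k * j) • m₁ := by
    have h1 := hstd₁ (k • p) fun i hi => hp i fun h0 => by simp [h0] at hi
    have h2 := hstd₁ (m₀ + (k * j) • m₁) fun i hi h0 => by
      have h3 : m₀ i = 0 := by
        by_contra h4
        exact Finsupp.mem_support_iff.1 (hm₀₁ (Finsupp.mem_support_iff.2 h4)) h0
      simp [h0, h3] at hi
    refine huniq' _ _ h1.1 h2.1 h1.2 h2.2 ?_
    rw [ev_add, hm₀x, hpx, ev_nsmul, ev_nsmul, nsmul_sub, mul_nsmul']
    abel
  have hle : j • m₁ ≤ p := by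
    intro i
    have h1 := DFunLike.congr_fun hkp i
    simp only [Finsupp.smul_apply, Finsupp.add_apply, smul_eq_mul] at h1 ⊢
    refine Nat.le_of_mul_le_mul_left ?_ hk
    rw [h1, ← mul_assoc]
    exact Nat.le_add_left _ _
  have hx' : x = ev (p - j • m₁) := by
    rw [hpx, ← ev_nsmul]
    conv_lhs => rw [← tsub_add_cancel_of_le hle, ev_add]
    rw [add_sub_cancel_right]
  rw [hx']
  refine comb_toReal_mem (hstd₁ _ fun i hi => hp i fun h0 => ?_).2
  simp [h0] at hi

end Normality

end MonoidalComplex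

/-! ### Unimodular triangulations yield radical monomial initial ideals -/

namespace MonoidalComplex

open MvPolynomial

/-- If each element `y` of `|M|` has a unique representation `std y` of least weight, and the monomials
`std y` form a set that is determined by supports, then the initial ideal is the Stanley–Reisner ideal
of the simplicial complex of these supports. -/
theorem isMonomialIdeal_isRadical_of_standard {M : MonoidalComplex S} {n : ℕ} {a : Fin n → M.Elem}
    {K : Type*} [Field K] {w : Fin n → ℕ} {std : M.Elem → (Fin n →₀ ℕ)}
    (hrep : ∀ y, Represents a (std y) y)
    (hlt : ∀ m y, Represents a m y → m ≠ std y → Finsupp.weight w (std y) < Finsupp.weight w m)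
    (hsupp : ∀ y (m : Fin n →₀ ℕ), (∀ i, m i ≠ 0 → std y i ≠ 0) → ∃ y', m = std y') :
    IsMonomialIdeal (initialIdeal w (M.presentationIdeal K a)) ∧
      (initialIdeal w (M.presentationIdeal K a)).IsRadical := by
  classical
  set A : Set (Fin n →₀ ℕ) := {m | ∀ y, m ≠ std y} with hA
  have hup : ∀ u ∈ A, ∀ m, u ≤ m → m ∈ A := by
    rintro u hu _ hum y rfl
    obtain ⟨y', hy'⟩ := hsupp y u fun i hi h0 => hi (Nat.le_zero.1 (h0 ▸ hum i))
    exact hu y' hy'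
  have hJ : initialIdeal w (M.presentationIdeal K a) =
      Ideal.span ((fun u => monomial u (1 : K)) '' A) := by
    apply le_antisymm
    · rw [initialIdeal, Ideal.span_le]
      rintro _ ⟨f, hf, rfl⟩
      rw [SetLike.mem_coe, mem_ideal_span_monomial_image]
      intro m hm
      refine ⟨m, ?_, le_rfl⟩
      rintro y rfl
      -- the leading monomial `std y` could cancel only with monomials of larger weight
      rw [mem_support_iff, initialComponent, coeff_weightedHomogeneousComponent, ite_ne_right_iff]
        at hm
      obtain ⟨m', hm', hne, hy⟩ := exists_represents_of_mem_presentationIdeal hf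
        (mem_support_iff.2 hm.2) (hrep y)
      have h1 := hlt m' y hy hne
      have h2 := le_weightedTotalDegree w hm'
      omega
    · rw [Ideal.span_le]
      rintro _ ⟨m, hm, rfl⟩
      by_cases h : ∃ y, Represents a m y
      · obtain ⟨y, hy⟩ := h
        have h1 := initialComponent_mem (w := w) (sub_mem_presentationIdeal (K := K) hy (hrep y))
        rwa [initialComponent_sub (hlt m y hy (hm y))] at h1
      · have h1 := initialComponent_mem (w := w) (monomial_mem_presentationIdeal (K := K) h)
        rwa [initialComponent_monomial] at h1
  refine ⟨⟨A, hJ⟩, ?_⟩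
  rintro f ⟨k, hk⟩
  rw [hJ, mem_ideal_span_monomial_image]
  intro m hm
  refine ⟨m, ?_, le_rfl⟩
  rintro y rfl
  -- the initial ideal is contained in the prime ideal of the variables outside of `supp (std y)`
  have hle : initialIdeal w (M.presentationIdeal K a) ≤
      Ideal.span (MvPolynomial.X '' {i | std y i = 0}) := by
    rw [hJ, Ideal.span_le]
    rintro _ ⟨u, hu, rfl⟩
    rw [SetLike.mem_coe, mem_ideal_span_X_image]
    intro v hv
    rw [Finset.mem_singleton.1 (support_monomial_subset hv)]
    by_contra! hcon
    obtain ⟨y', hy'⟩ := hsupp y u fun i hi h0 => hi (hcon i h0)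
    exact hu y' hy'
  obtain ⟨i, hi, hi'⟩ := mem_ideal_span_X_image.1 (mem_span_X_of_pow_mem (hle hk)) _ hm
  exact hi' hi

/-- Finitely many strict linear inequalities that are satisfied by a nonnegative real weight vector
are satisfied by a vector of natural numbers. -/
theorem exists_nat_weight {n : ℕ} {w : Fin n → ℝ} (hw : ∀ i, 0 ≤ w i) {D : Set (Fin n →₀ ℝ)}
    (hD : D.Finite) (h : ∀ r ∈ D, 0 < weigh w r) :
    ∃ w' : Fin n → ℕ, ∀ r ∈ D, 0 < weigh (fun i => (w' i : ℝ)) r := by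
  have h1 : ∀ r ∈ D, ∀ᶠ N : ℝ in atTop, 0 < weigh (fun i => (⌊w i * N⌋₊ : ℝ)) r := by
    intro r hr
    have hlim : Tendsto (fun N : ℝ => weigh (fun i => (⌊w i * N⌋₊ : ℝ) / N) r) atTop
        (𝓝 (weigh w r)) := by
      simp only [Finsupp.linearCombination_apply, Finsupp.sum, smul_eq_mul]
      exact tendsto_finsetSum _ fun i _ => (tendsto_nat_floor_mul_div_atTop (hw i)).const_mul _
    filter_upwards [hlim.eventually (lt_mem_nhds (h r hr)), eventually_gt_atTop 0] with N hN hN0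
    have h2 : weigh (fun i => (⌊w i * N⌋₊ : ℝ) / N) r =
        weigh (fun i => (⌊w i * N⌋₊ : ℝ)) r / N := by
      simp only [Finsupp.linearCombination_apply, Finsupp.sum, smul_eq_mul, Finset.sum_div,
        mul_div_assoc]
    rw [h2] at hN
    exact (div_pos_iff_of_pos_right hN0).1 hN
  obtain ⟨N, hN⟩ := ((hD.eventually_all).2 h1).exists
  exact ⟨fun i => ⌊w i * N⌋₊, hN⟩

theorem weigh_toReal {n : ℕ} (w : Fin n → ℕ) (m : Fin n →₀ ℕ) :
    weigh (fun i => (w i : ℝ)) (toReal m) = (Finsupp.weight w m : ℝ) := by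
  rw [Finsupp.weight_apply, Finsupp.linearCombination_apply, Finsupp.sum_fintype _ _ (by simp),
    Finsupp.sum_fintype _ _ (by simp)]
  simp

/-- If optimality of the combinations `std y` has been secured for finitely many monomials, the
minimal nonstandard ones, then it holds for all monomials. -/
theorem exists_weight_of_finite_inequalities {M : MonoidalComplex S} {n : ℕ} {a : Fin n → M.Elem}
    {std : M.Elem → (Fin n →₀ ℕ)} (hrep : ∀ y, Represents a (std y) y)
    (hw : ∀ D : Set ((Fin n →₀ ℕ) × M.Elem), D.Finite →
      (∀ p ∈ D, Represents a p.1 p.2 ∧ p.1 ≠ std p.2) →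
      ∃ w : Fin n → ℝ, (∀ i, 0 ≤ w i) ∧
        ∀ p ∈ D, weigh w (toReal (std p.2)) < weigh w (toReal p.1)) :
    ∃ w : Fin n → ℕ, ∀ m y, Represents a m y → m ≠ std y →
      Finsupp.weight w (std y) < Finsupp.weight w m := by
  set B : Set (Fin n →₀ ℕ) := {m | ∃ y, Represents a m y ∧ m ≠ std y} with hB
  have hBfin : {m | Minimal (· ∈ B) m}.Finite :=
    WellQuasiOrderedLE.finite_of_isAntichain (setOfPred_minimal_antichain _)
  set D : Set ((Fin n →₀ ℕ) × M.Elem) :=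
    {p | Minimal (· ∈ B) p.1 ∧ Represents a p.1 p.2 ∧ p.1 ≠ std p.2} with hD
  have hDfin : D.Finite := by
    refine Set.Finite.of_finite_image (f := Prod.fst) (hBfin.subset ?_) ?_
    · rintro _ ⟨p, hp, rfl⟩
      exact hp.1
    · rintro ⟨m, y⟩ hp ⟨m', y'⟩ hp' (rfl : m = m')
      exact congrArg (Prod.mk m) (hp.2.1.unique hp'.2.1)
  obtain ⟨w, hw0, hwD⟩ := hw D hDfin fun p hp => hp.2
  obtain ⟨w', hw'⟩ := exists_nat_weight hw0
    (hDfin.image fun p => toReal p.1 - toReal (std p.2)) (by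
      rintro _ ⟨p, hp, rfl⟩
      rw [map_sub, sub_pos]
      exact hwD p hp)
  have hlt : ∀ p ∈ D, Finsupp.weight w' (std p.2) < Finsupp.weight w' p.1 := by
    intro p hp
    have := hw' _ ⟨p, hp, rfl⟩
    rw [map_sub, sub_pos, weigh_toReal, weigh_toReal] at this
    exact_mod_cast this
  refine ⟨w', fun m y hm hne => ?_⟩
  induction hk : Finsupp.weight w' m using Nat.strong_induction_on generalizing m with
  | _ k ih =>
  -- replace a minimal nonstandard divisor by the standard monomial for the same element
  obtain ⟨u, hum, hu⟩ := exists_minimal_le_of_wellFoundedLT (· ∈ B) m ⟨y, hm, hne⟩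
  obtain ⟨z, hz, huz⟩ := hu.prop
  have h1 := hlt (u, z) ⟨hu, hz, huz⟩
  have hmu : u + (m - u) = m := add_tsub_cancel_of_le hum
  have h2 : Represents a (std z + (m - u)) y := by
    rw [← hmu] at hm
    obtain ⟨z', v, hz', hv, hsum⟩ := hm.exists_of_add
    rw [hz'.unique hz] at hsum
    exact (hrep z).add hv hsum
  have h3 : Finsupp.weight w' (std z + (m - u)) < k := by
    rw [← hk]
    conv_rhs => rw [← hmu]
    rw [map_add, map_add]
    exact Nat.add_lt_add_right h1 _
  by_cases h4 : std z + (m - u) = std y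
  · rw [← h4]
    exact h3
  · exact (ih _ h3 _ h2 h4 rfl).trans h3

/-- The vertices of a unimodular triangulation of a normal monoidal complex, together with suitable
weights, define a radical monomial initial ideal. -/
theorem exists_generates_isMonomialIdeal_isRadical (K : Type*) [Field K] (M : MonoidalComplex S)
    (hM : ∀ c : S.faces, IsNormalMonoid (M.monoid c)) :
    ∃ (n : ℕ) (a : Fin n → M.Elem) (w : Fin n → ℕ), M.Generates a ∧
      IsMonomialIdeal (initialIdeal w (M.presentationIdeal K a)) ∧
      (initialIdeal w (M.presentationIdeal K a)).IsRadical := by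
  obtain ⟨T₀⟩ := M.exists_triangulation
  obtain ⟨T, hT⟩ := T₀.exists_unimodular hM
  choose k hk using hT
  set a : Fin T.verts.card → M.Elem := fun i => (T.verts.equivFin.symm i : M.Elem) with ha
  have hinj : Function.Injective a :=
    Subtype.val_injective.comp T.verts.equivFin.symm.injective
  have hmem : ∀ i, a i ∈ T.verts := fun i => (T.verts.equivFin.symm i).2
  have hsurj : ∀ e ∈ T.verts, ∃ i, a i = e := fun e he =>
    ⟨T.verts.equivFin ⟨e, he⟩, by simp [ha]⟩
  set std : M.Elem → (Fin T.verts.card →₀ ℕ) :=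
    fun y => Finsupp.equivFunOnFinite.symm fun i => k y (a i) with hstd
  have hstd_apply : ∀ y i, std y i = k y (a i) := fun y i => rfl
  -- coefficient vectors on the vertices and on their indices
  set ext : (Fin T.verts.card →₀ ℕ) → (M.Elem →₀ ℝ) := fun m => (toReal m).mapDomain a with hext
  have hext_apply : ∀ m i, ext m (a i) = m i := fun m i => by
    rw [hext]
    exact Finsupp.mapDomain_apply hinj _ _
  have hext_not : ∀ m e, e ∉ T.verts → ext m e = 0 := fun m e he => by
    refine Finsupp.mapDomain_of_notMem_range _ _ ?_
    rintro ⟨i, rfl⟩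
    exact he (hmem i)
  have hext_nonneg : ∀ m, 0 ≤ ext m := by
    intro m e
    by_cases he : e ∈ T.verts
    · obtain ⟨i, rfl⟩ := hsurj e he
      rw [hext_apply]
      exact Nat.cast_nonneg _
    · rw [hext_not m e he]
      exact le_rfl
  have hext_mem : ∀ m e, ext m e ≠ 0 → e ∈ T.verts := fun m e he => by_contra fun h =>
    he (hext_not m e h)
  have hext_inj : ∀ m m', ext m = ext m' → m = m' := by
    intro m m' h
    ext i
    have := DFunLike.congr_fun h (a i)
    rw [hext_apply, hext_apply] at this
    exact_mod_cast this
  have hext_std : ∀ y, ext (std y) = T.std y.1 := by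
    intro y
    ext e
    by_cases he : e ∈ T.verts
    · obtain ⟨i, rfl⟩ := hsurj e he
      rw [hext_apply, hstd_apply, hk]
    · obtain ⟨c, hc⟩ := y.exists_face
      rw [hext_not _ e he]
      by_contra h
      exact he (T.std_mem c _ hc e (Ne.symm h))
  have hcomb : ∀ (c : S.faces) m p, S.IsComb c (fun i => (a i).pt) (toReal m) p ↔
      S.IsComb c Elem.pt (ext m) p := by
    intro c m p
    have h1 : S.comb c Elem.pt (ext m) = S.comb c (fun i => (a i).pt) (toReal m) :=
      Finsupp.linearCombination_mapDomain ℝ _ _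
    have h2 : S.InFace c Elem.pt (ext m) ↔ S.InFace c (fun i => (a i).pt) (toReal m) := by
      constructor
      · intro h i hi
        exact h (a i) (by rwa [hext_apply])
      · intro h e he
        obtain ⟨i, rfl⟩ := hsurj e (hext_mem m e he)
        exact h i (by rwa [hext_apply] at he)
    rw [ConicalComplex.IsComb, ConicalComplex.IsComb, h1, h2]
  have hrep : ∀ y, Represents a (std y) y := by
    intro y
    obtain ⟨c, hc⟩ := y.exists_face
    refine ⟨c, (hcomb c _ _).2 ?_⟩
    rw [hext_std]
    exact T.isComb_std c _ hc
  obtain ⟨w, hw⟩ := exists_weight_of_finite_inequalities hrep (by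
    intro D hD hDne
    have h1 : ∀ p ∈ D, ∀ᶠ w in T.weights, weigh w (T.std p.2.1) < weigh w (ext p.1) := by
      intro p hp
      obtain ⟨⟨c, hc⟩, hne⟩ := hDne p hp
      refine T.std_lt c _ _ ((hcomb c _ _).1 hc) (hext_nonneg _) (hext_mem _) fun h => hne ?_
      rw [← hext_std] at h
      exact hext_inj _ _ h
    have := T.neBot
    obtain ⟨w, hw, hwpos⟩ := (((hD.eventually_all).2 h1).and T.weights_pos).exists
    refine ⟨fun i => w (a i), fun i => (hwpos _).le, fun p hp => ?_⟩
    have h2 : ∀ m, weigh (fun i => w (a i)) (toReal m) = weigh w (ext m) := fun m =>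
      (Finsupp.linearCombination_mapDomain ℝ _ _).symm
    rw [h2, h2, hext_std]
    exact hw p hp)
  refine ⟨_, a, w, fun c => ?_, isMonomialIdeal_isRadical_of_standard hrep hw ?_⟩
  · apply le_antisymm
    · rw [AddSubmonoid.closure_le]
      exact fun x hx => hx.1
    · intro x hx
      obtain ⟨y, hy, hyx, -⟩ := exists_elem hx
      obtain ⟨h1, -, h2⟩ := (hrep y).isComb hy
      rw [← hyx, ← h2, comb_apply]
      refine sum_mem fun i hi => ?_
      beta_reduce
      rw [toReal_apply, Nat.cast_smul_eq_nsmul]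
      have hic := h1 i (Finsupp.mem_support_iff.1 hi)
      refine nsmul_mem (AddSubmonoid.subset_closure ?_) _
      exact ⟨coord_mem_monoid (a i) hic, i, (chart_coord hic).symm⟩
  · intro y m hm
    obtain ⟨c, hc⟩ := y.exists_face
    have h1 := (hrep y).isComb hc
    obtain ⟨y', hy', -, hmy'⟩ := MonoidalComplex.exists_represents (inFace_toReal_mono h1.1 hm)
    refine ⟨y', hext_inj _ _ ?_⟩
    rw [hext_std]
    refine (T.std_eq_of_support hc (hext_nonneg m) (fun e he => ?_)
      ((hcomb c _ _).1 (hmy'.isComb hy'))).symm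
    obtain ⟨i, rfl⟩ := hsurj e (hext_mem m e he)
    rw [← hext_std, hext_apply, Nat.cast_ne_zero]
    rw [hext_apply, Nat.cast_ne_zero] at he
    exact hm i he

end MonoidalComplex

end

theorem theorem3p10 (K : Type*) [Field K] {X : Type*} {S : ConicalComplex X}
    (M : MonoidalComplex S) :
    (∀ c : S.faces, IsNormalMonoid (M.monoid c)) ↔
      ∃ (n : ℕ) (a : Fin n → M.Elem) (w : Fin n → ℕ),
        M.Generates a ∧
        IsMonomialIdeal (initialIdeal w (M.presentationIdeal K a)) ∧
        (initialIdeal w (M.presentationIdeal K a)).IsRadical := by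
  refine ⟨M.exists_generates_isMonomialIdeal_isRadical K, ?_⟩
  rintro ⟨n, a, w, ha, hmon, hrad⟩
  exact MonoidalComplex.isNormalMonoid_of_standard
    (Std := fun m => MvPolynomial.monomial m (1 : K) ∉ initialIdeal w (M.presentationIdeal K a))
    (MonoidalComplex.exists_represents_notMem_initialIdeal ha)
    (fun m m' y h h' hm hm' => MonoidalComplex.eq_of_notMem_initialIdeal hmon hm hm' h h')
    (fun m m' h hm => MonoidalComplex.notMem_of_support hrad h hm)
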